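/- Let $N\ge 2$. For an open set $E\subseteq\mathbb{R}^N$ let $C^\infty_0(E)$ be the set of smooth real functions whose support is a compact subset of $E$, and for a compact set $\Sigma\subseteq E$ let $$\mathrm{cap}_1(\Sigma;E)=\inf\Big\{\int_E|\nabla\varphi|\,dx\ :\ \varphi\in C^\infty_0(E),\ \varphi\ge 1\text{ on }\Sigma\Big\}.$$ For $0<\gamma<1$ and an open set $\Omega\subseteq\mathbb{R}^N$, the capacitary inradius $R_{1,\gamma}(\Omega)\in[0,+\infty]$ is the supremum of all $r>0$ for which there is $x_0\in\mathbb{R}^N$ with $$\mathrm{cap}_1\big(\overline{B_r(x_0)}\setminus\Omega;B_{2r}(x_0)\big)\le\gamma\,\mathrm{cap}_1\big(\overline{B_r(x_0)};B_{2r}(x_0)\big)$$ (and $R_{1,\gamma}(\Omega)=0$ if there is no such $r$). The Cheeger constant of $\Omega$ is $$h(\Omega)=\inf\Big\{\frac{\mathcal{H}^{N-1}(\partial E)}{|E|}\ :\ E\Subset\Omega\text{ nonempty open set with smooth boundary}\Big\}\in[0,+\infty],$$ with $h(\emptyset)=+\infty$. In what follows, $1/0=+\infty$ and $1/{+\infty}=0$.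 There are a constant $\sigma_{N,1}>0$, depending only on $N$, and, for every $0<\gamma<1$, a constant $C_{N,1,\gamma}>0$, depending only on $N$ and $\gamma$, such that for every $0<\gamma<1$ and every open set $\Omega\subseteq\mathbb{R}^N$ $$\sigma_{N,1}\,\gamma\,\frac{1}{R_{1,\gamma}(\Omega)}\le h(\Omega)\le C_{N,1,\gamma}\,\frac{1}{R_{1,\gamma}(\Omega)}.$$ The constant $C_{N,1,\gamma}$ diverges to $+\infty$ as $\gamma\nearrow 1$, and necessarily so: if constants $C'_\gamma$, $0<\gamma<1$, are such that $h(\Omega)\le C'_\gamma/R_{1,\gamma}(\Omega)$ for every $0<\gamma<1$ and every open set $\Omega\subseteq\mathbb{R}^N$, then $C'_\gamma\to+\infty$ as $\gamma\nearrow1$. In particular, for every open set $\Omega\subseteq\mathbb{R}^N$ and every $0<\gamma<1$, $$h(\Omega)>0\quad\Longleftrightarrow\quad R_{1,\gamma}(\Omega)<+\infty,$$ and the last condition does not depend on $0<\gamma<1$. -/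

import Mathlib

open Set Filter Topology MeasureTheory
open scoped ENNReal

namespace CapacitaryInradius

/-- The space `C₀^∞(E)`: smooth real functions on `ℝ^N` whose support is a compact subset
of `E`. -/
def testFunctions {N : ℕ} (E : Set (EuclideanSpace ℝ (Fin N))) :
    Set (EuclideanSpace ℝ (Fin N) → ℝ) :=
  {φ | ContDiff ℝ (⊤ : ℕ∞) φ ∧ HasCompactSupport φ ∧ tsupport φ ⊆ E}

/-- The `p`-capacity of `S` relative to `E` (meant for `E` open and `S ⊆ E` compact):
the infimum of `∫_E |∇φ|^p` over the test functions `φ` of `E` with `φ ≥ 1` on `S`. -/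
noncomputable def relCap {N : ℕ} (p : ℝ) (S E : Set (EuclideanSpace ℝ (Fin N))) : ℝ≥0∞ :=
  ⨅ φ ∈ {φ ∈ testFunctions E | ∀ x ∈ S, 1 ≤ φ x}, ∫⁻ x in E, ‖gradient φ x‖ₑ ^ p

/-- A compact set `S ⊆ closedBall x₀ r` is `(p, γ)`-negligible. -/
def IsNegligible {N : ℕ} (p γ : ℝ) (x₀ : EuclideanSpace ℝ (Fin N)) (r : ℝ)
    (S : Set (EuclideanSpace ℝ (Fin N))) : Prop :=
  IsCompact S ∧ S ⊆ Metric.closedBall x₀ r ∧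
    relCap p S (Metric.ball x₀ (2 * r)) ≤
      ENNReal.ofReal γ * relCap p (Metric.closedBall x₀ r) (Metric.ball x₀ (2 * r))

/-- The capacitary inradius `R_{p,γ}(Ω)`, with values in `[0, +∞]`. -/
noncomputable def capInradius {N : ℕ} (p γ : ℝ) (Ω : Set (EuclideanSpace ℝ (Fin N))) : ℝ≥0∞ :=
  ⨆ r ∈ {r : ℝ | 0 < r ∧ ∃ x₀, IsNegligible p γ x₀ r (Metric.closedBall x₀ r \ Ω)},
    ENNReal.ofReal r

/-- `E` has smooth boundary: near every boundary point, `E` is the sublevel set `{f < 0}` of a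
smooth function `f` which vanishes at that point and has nonzero gradient there. -/
def HasSmoothBoundary {N : ℕ} (E : Set (EuclideanSpace ℝ (Fin N))) : Prop :=
  ∀ x ∈ frontier E, ∃ U : Set (EuclideanSpace ℝ (Fin N)), IsOpen U ∧ x ∈ U ∧
    ∃ f : EuclideanSpace ℝ (Fin N) → ℝ, ContDiffOn ℝ (⊤ : ℕ∞) f U ∧ f x = 0 ∧ gradient f x ≠ 0 ∧
      E ∩ U = {y ∈ U | f y < 0}

/-- The sets competing in the definition of the Cheeger constant of `Ω`: the nonempty open sets
with smooth boundary whose closure is a compact subset of `Ω`. -/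
def cheegerSets {N : ℕ} (Ω : Set (EuclideanSpace ℝ (Fin N))) :
    Set (Set (EuclideanSpace ℝ (Fin N))) :=
  {E | IsOpen E ∧ E.Nonempty ∧ IsCompact (closure E) ∧ closure E ⊆ Ω ∧ HasSmoothBoundary E}

/-- The Cheeger constant `h(Ω)`, with values in `[0, +∞]` (it is `+∞` for `Ω = ∅`).
Here `μHE[N - 1]` is the Hausdorff measure `ℋ^{N-1}`, normalized so as to agree with the
Lebesgue measure on `(N-1)`-dimensional Euclidean space. -/
noncomputable def cheegerConstant {N : ℕ} (Ω : Set (EuclideanSpace ℝ (Fin N))) : ℝ≥0∞ :=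
  ⨅ E ∈ cheegerSets Ω,
    (μHE[N - 1] : Measure (EuclideanSpace ℝ (Fin N))) (frontier E) / volume E

end CapacitaryInradius

/-!
Lower bound. Let `r > R_{1,γ}(Ω)`. For a test function `u` of `Ω` and `c = u y ≠ 0`, the function
`η (1 - u / c)`, with `η` a cutoff of `B_r(y)`, competes for the capacity of `B_r(y) \ Ω`, which
exceeds `γ` times that of `B_r(y)`. Integrating over `y` gives `∫ |u| ≤ (K r / γ) ∫ |∇u|`. For a
competitor `E` of the Cheeger constant, cover `∂E` by finitely many small balls nearly realizing its
Hausdorff measure and insert for `u` the indicator of `E` cut off near these balls.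

Upper bound. Let `B_r \ Ω` be `γ`-negligible and `φ` nearly optimal for its capacity. Then
`u = η (1 - φ)` is nonpositive off `Ω` and `∫ |∇u|` is at most of order `r ^ (N - 1)`, while
`∫ (1 - φ)⁺` is at least of order `r ^ N`: if it were small, adding to `φ` a cutoff of `(1 - φ)⁺`
would give a competitor for a slightly smaller ball with too little energy. Finally
`h(Ω) ∫ u⁺ ≤ K ∫ |∇u|` by the coarea inequality. In place of Sard's theorem for `u`, a small
linear function is added to `u`: by the equidimensional Sard theorem for `∇u`, almost every one
makes all critical points nondegenerate, hence finite in number on a compact set, so that all but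
finitely many superlevel sets have smooth boundary.

Divergence. The thin shells `{γ < |x| < 2 - γ}` have `R_{1,γ} ≥ 1`, since the hole `|x| ≤ γ` is
negligible in the unit ball, but a Cheeger constant which tends to infinity.
-/

namespace CapacitaryInradius

section Calculus

theorem enorm_add_sub_le_lintegral_fderiv {E F : Type*} [NormedAddCommGroup E] [NormedSpace ℝ E]
    [NormedAddCommGroup F] [NormedSpace ℝ F] [CompleteSpace F] {φ : E → F} (hφ : ContDiff ℝ 1 φ)
    (x v : E) :
    ‖φ (x + v) - φ x‖ₑ ≤ ∫⁻ t in Ioc (0 : ℝ) 1, ‖v‖ₑ * ‖fderiv ℝ φ (x + t • v)‖ₑ := by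
  have : Continuous (fderiv ℝ φ) := hφ.continuous_fderiv one_ne_zero
  have hder (t : ℝ) : HasDerivAt (fun t : ℝ => φ (x + t • v)) (fderiv ℝ φ (x + t • v) v) t := by
    have hline : HasDerivAt (fun t : ℝ => x + t • v) v t := by
      simpa using ((hasDerivAt_id t).smul_const v).const_add x
    exact (hφ.differentiable one_ne_zero _).hasFDerivAt.comp_hasDerivAt t hline
  have hc : Continuous fun t : ℝ => fderiv ℝ φ (x + t • v) v := by fun_prop
  have hftc := intervalIntegral.integral_eq_sub_of_hasDerivAt (fun t _ => hder t)
    (hc.intervalIntegrable 0 1)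
  simp only [one_smul, zero_smul, add_zero] at hftc
  rw [← hftc, intervalIntegral.integral_of_le zero_le_one]
  refine (enorm_integral_le_lintegral_enorm _).trans (lintegral_mono fun t => ?_)
  rw [mul_comm]
  exact ContinuousLinearMap.le_opENorm _ _

theorem support_enorm_fderiv_subset {E F : Type*} [NormedAddCommGroup E] [NormedSpace ℝ E]
    [NormedAddCommGroup F] [NormedSpace ℝ F] (φ : E → F) :
    (Function.support fun x => ‖fderiv ℝ φ x‖ₑ) ⊆ tsupport φ := by
  refine fun x hx => support_fderiv_subset ℝ fun h => hx ?_
  change ‖fderiv ℝ φ x‖ₑ = 0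
  rw [← ofReal_norm, h, norm_zero, ENNReal.ofReal_zero]

theorem setLIntegral_enorm_fderiv {E F : Type*} [NormedAddCommGroup E] [NormedSpace ℝ E]
    [NormedAddCommGroup F] [NormedSpace ℝ F] [MeasurableSpace E] (μ : Measure E) {φ : E → F}
    {U : Set E} (hU : tsupport φ ⊆ U) :
    ∫⁻ x in U, ‖fderiv ℝ φ x‖ₑ ∂μ = ∫⁻ x, ‖fderiv ℝ φ x‖ₑ ∂μ :=
  setLIntegral_eq_of_support_subset ((support_enorm_fderiv_subset φ).trans hU)

variable {E : Type*} [NormedAddCommGroup E] [NormedSpace ℝ E] [FiniteDimensional ℝ E]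
  [MeasurableSpace E] [BorelSpace E] (μ : Measure E) [μ.IsAddHaarMeasure]

theorem lintegral_comp_smul (f : E → ℝ≥0∞) {s : ℝ} (hs : 0 < s) :
    ∫⁻ x, f (s • x) ∂μ = ENNReal.ofReal ((s ^ Module.finrank ℝ E)⁻¹) * ∫⁻ x, f x ∂μ := by
  have h := lintegral_map_equiv (μ := μ) f (Homeomorph.smulOfNeZero s hs.ne').toMeasurableEquiv
  simp only [Homeomorph.toMeasurableEquiv_coe, Homeomorph.smulOfNeZero_apply] at h
  rw [← h, Measure.map_addHaar_smul μ hs.ne', lintegral_smul_measure, abs_of_pos (by positivity),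
    smul_eq_mul]

section Increments

variable {F : Type*} [NormedAddCommGroup F] [NormedSpace ℝ F] [CompleteSpace F]

theorem lintegral_enorm_translate_sub_le {φ : E → F} (hφ : ContDiff ℝ 1 φ) (h : E) :
    ∫⁻ x, ‖φ (x + h) - φ x‖ₑ ∂μ ≤ ‖h‖ₑ * ∫⁻ x, ‖fderiv ℝ φ x‖ₑ ∂μ := by
  have : Continuous (fderiv ℝ φ) := hφ.continuous_fderiv one_ne_zero
  calc ∫⁻ x, ‖φ (x + h) - φ x‖ₑ ∂μ
      ≤ ∫⁻ x, (∫⁻ t in Ioc (0 : ℝ) 1, ‖h‖ₑ * ‖fderiv ℝ φ (x + t • h)‖ₑ) ∂μ :=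
        lintegral_mono fun x => enorm_add_sub_le_lintegral_fderiv hφ x h
    _ = ∫⁻ t in Ioc (0 : ℝ) 1, (∫⁻ x, ‖h‖ₑ * ‖fderiv ℝ φ (x + t • h)‖ₑ ∂μ) := by
        refine lintegral_lintegral_swap (Measurable.aemeasurable ?_)
        have : Continuous fun p : E × ℝ => fderiv ℝ φ (p.1 + p.2 • h) := by fun_prop
        exact this.enorm.measurable.const_mul _
    _ = ∫⁻ _ in Ioc (0 : ℝ) 1, (‖h‖ₑ * ∫⁻ x, ‖fderiv ℝ φ x‖ₑ ∂μ) := by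
        refine lintegral_congr fun t => ?_
        rw [lintegral_const_mul' _ _ enorm_ne_top,
          lintegral_add_right_eq_self (fun x => ‖fderiv ℝ φ x‖ₑ) (t • h)]
    _ = ‖h‖ₑ * ∫⁻ x, ‖fderiv ℝ φ x‖ₑ ∂μ := by simp

theorem lintegral_enorm_dilate_sub_le {φ : E → F} (hφ : ContDiff ℝ 1 φ) {R l : ℝ} (hR : 0 ≤ R)
    (hts : tsupport φ ⊆ Metric.closedBall 0 R) (hl : 0 < l) (hl1 : l ≤ 1) :
    ∫⁻ x, ‖φ (l • x) - φ x‖ₑ ∂μ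
      ≤ ENNReal.ofReal ((1 - l) * (R / l) * (l ^ Module.finrank ℝ E)⁻¹) *
        ∫⁻ x, ‖fderiv ℝ φ x‖ₑ ∂μ := by
  have : Continuous (fderiv ℝ φ) := hφ.continuous_fderiv one_ne_zero
  have hseg (x : E) (t : ℝ) : x + t • ((l - 1) • x) = (1 - t * (1 - l)) • x := by module
  have : 0 ≤ 1 - l := sub_nonneg.2 hl1
  have hsl {t : ℝ} (ht : t ∈ Ioc (0 : ℝ) 1) : l ≤ 1 - t * (1 - l) := by nlinarith [ht.2]
  -- On the segment from `x` to `l • x`, the derivative only lives where `‖x‖ ≤ R / l`.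
  have hpt (x : E) {t : ℝ} (ht : t ∈ Ioc (0 : ℝ) 1) :
      ‖(l - 1) • x‖ₑ * ‖fderiv ℝ φ ((1 - t * (1 - l)) • x)‖ₑ
        ≤ ENNReal.ofReal ((1 - l) * (R / l)) * ‖fderiv ℝ φ ((1 - t * (1 - l)) • x)‖ₑ := by
    rcases eq_or_ne (‖fderiv ℝ φ ((1 - t * (1 - l)) • x)‖ₑ) 0 with h0 | h0
    · simp [h0]
    gcongr
    have hmem := mem_closedBall_zero_iff.1 (hts (support_enorm_fderiv_subset φ h0))
    rw [norm_smul, Real.norm_of_nonneg (hl.le.trans (hsl ht))] at hmem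
    have hx : ‖x‖ ≤ R / l := by
      rw [le_div_iff₀' hl]
      exact (mul_le_mul_of_nonneg_right (hsl ht) (norm_nonneg x)).trans hmem
    rw [← ofReal_norm, norm_smul, Real.norm_of_nonpos (by linarith), neg_sub]
    gcongr
  calc ∫⁻ x, ‖φ (l • x) - φ x‖ₑ ∂μ
      ≤ ∫⁻ x, (∫⁻ t in Ioc (0 : ℝ) 1, ENNReal.ofReal ((1 - l) * (R / l)) *
          ‖fderiv ℝ φ ((1 - t * (1 - l)) • x)‖ₑ) ∂μ := by
        refine lintegral_mono fun x => ?_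
        have h := enorm_add_sub_le_lintegral_fderiv hφ x ((l - 1) • x)
        simp only [hseg, show x + (l - 1) • x = l • x by module] at h
        exact h.trans (setLIntegral_mono' measurableSet_Ioc fun t ht => hpt x ht)
    _ = ∫⁻ t in Ioc (0 : ℝ) 1, (∫⁻ x, ENNReal.ofReal ((1 - l) * (R / l)) *
          ‖fderiv ℝ φ ((1 - t * (1 - l)) • x)‖ₑ ∂μ) := by
        refine lintegral_lintegral_swap (Measurable.aemeasurable ?_)
        have : Continuous fun p : E × ℝ => fderiv ℝ φ ((1 - p.2 * (1 - l)) • p.1) := by fun_prop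
        exact this.enorm.measurable.const_mul _
    _ ≤ ∫⁻ _ in Ioc (0 : ℝ) 1, (ENNReal.ofReal ((1 - l) * (R / l) *
          (l ^ Module.finrank ℝ E)⁻¹) * ∫⁻ x, ‖fderiv ℝ φ x‖ₑ ∂μ) := by
        refine setLIntegral_mono' measurableSet_Ioc fun t ht => ?_
        rw [lintegral_const_mul' _ _ ENNReal.ofReal_ne_top,
          lintegral_comp_smul μ (fun x => ‖fderiv ℝ φ x‖ₑ) (hl.trans_le (hsl ht)), ← mul_assoc,
          ← ENNReal.ofReal_mul (mul_nonneg (by linarith) (by positivity))]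
        gcongr
        exact hsl ht
    _ = _ := by simp

theorem lintegral_enorm_le_of_tsupport_subset_ball [Nontrivial E] {φ : E → F}
    (hφ : ContDiff ℝ 1 φ) {x₀ : E} {R : ℝ} (hR : 0 < R) (hts : tsupport φ ⊆ Metric.ball x₀ R) :
    ∫⁻ x, ‖φ x‖ₑ ∂μ ≤ ENNReal.ofReal (2 * R) * ∫⁻ x, ‖fderiv ℝ φ x‖ₑ ∂μ := by
  obtain ⟨h, hh⟩ := exists_norm_eq E (show 0 ≤ 2 * R by positivity)
  -- Translating by `h` moves the ball off itself.
  have hzero {x : E} (hx : x ∈ Metric.ball x₀ R) : φ (x + h) = 0 := by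
    refine image_eq_zero_of_notMem_tsupport fun hmem => ?_
    have h1 := mem_ball_iff_norm.1 (hts hmem)
    have h2 := mem_ball_iff_norm.1 hx
    have h3 : ‖h‖ ≤ ‖x + h - x₀‖ + ‖x - x₀‖ := by
      simpa using norm_sub_le (x + h - x₀) (x - x₀)
    linarith
  calc ∫⁻ x, ‖φ x‖ₑ ∂μ = ∫⁻ x in Metric.ball x₀ R, ‖φ x‖ₑ ∂μ := by
        refine (setLIntegral_eq_of_support_subset fun x hx => hts (subset_tsupport φ ?_)).symm
        simpa using hx
    _ = ∫⁻ x in Metric.ball x₀ R, ‖φ (x + h) - φ x‖ₑ ∂μ := by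
        refine setLIntegral_congr_fun Metric.isOpen_ball.measurableSet fun x hx => ?_
        simp [hzero hx]
    _ ≤ ∫⁻ x, ‖φ (x + h) - φ x‖ₑ ∂μ := setLIntegral_le_lintegral _ _
    _ ≤ ‖h‖ₑ * ∫⁻ x, ‖fderiv ℝ φ x‖ₑ ∂μ := lintegral_enorm_translate_sub_le μ hφ h
    _ = ENNReal.ofReal (2 * R) * ∫⁻ x, ‖fderiv ℝ φ x‖ₑ ∂μ := by rw [← ofReal_norm, hh]

theorem lintegral_enorm_le_of_tsupport_subset_shell {φ : E → F} (hφ : ContDiff ℝ 1 φ) {a b : ℝ}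
    (ha : 0 < a) (hab : a ≤ b) (hts : tsupport φ ⊆ Metric.ball 0 b \ Metric.closedBall 0 a) :
    ∫⁻ x, ‖φ x‖ₑ ∂μ
      ≤ ENNReal.ofReal ((1 - a / b) * (b / (a / b)) * ((a / b) ^ Module.finrank ℝ E)⁻¹) *
        ∫⁻ x, ‖fderiv ℝ φ x‖ₑ ∂μ := by
  have hb : 0 < b := ha.trans_le hab
  refine le_trans (lintegral_mono fun x => ?_) (lintegral_enorm_dilate_sub_le μ hφ hb.le
    (hts.trans (sdiff_subset.trans Metric.ball_subset_closedBall)) (div_pos ha hb)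
    ((div_le_one hb).2 hab))
  by_cases hx : x ∈ Metric.ball 0 b
  · have hlx : φ ((a / b) • x) = 0 := by
      refine image_eq_zero_of_notMem_tsupport fun h => (hts h).2 (mem_closedBall_zero_iff.2 ?_)
      rw [norm_smul, Real.norm_of_nonneg (by positivity), div_mul_eq_mul_div, div_le_iff₀ hb]
      exact mul_le_mul_of_nonneg_left (mem_ball_zero_iff.1 hx).le ha.le
    simp [hlx]
  · have : φ x = 0 := image_eq_zero_of_notMem_tsupport fun h => hx (hts h).1
    simp [this]

end Increments

end Calculus

section Cutoff

theorem exists_cutoff (E : Type*) [NormedAddCommGroup E] [InnerProductSpace ℝ E]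
    [FiniteDimensional ℝ E] {a b : ℝ} (ha : 0 < a) (hab : a < b) :
    ∃ L : ℝ, 0 < L ∧ ∀ (x₀ : E) (r : ℝ), 0 < r → ∃ η : E → ℝ, ContDiff ℝ (⊤ : ℕ∞) η ∧
      (∀ x, η x ∈ Icc (0 : ℝ) 1) ∧ (∀ x ∈ Metric.closedBall x₀ (a * r), η x = 1) ∧
      tsupport η ⊆ Metric.ball x₀ (b * r) ∧ ∀ x, ‖fderiv ℝ η x‖ ≤ L / r := by
  let f : ContDiffBump (0 : E) := ⟨a, (a + b) / 2, ha, by linarith⟩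
  have hf : ContDiff ℝ (⊤ : ℕ∞) f := f.contDiff
  obtain ⟨L, hL⟩ := (f.hasCompactSupport.fderiv (𝕜 := ℝ)).exists_bound_of_continuous
    (hf.continuous_fderiv (by simp))
  refine ⟨max L 1, by positivity, fun x₀ r hr => ?_⟩
  have hnorm (x : E) : ‖r⁻¹ • (x - x₀)‖ = dist x x₀ / r := by
    rw [norm_smul, norm_inv, Real.norm_of_nonneg hr.le, dist_eq_norm, inv_mul_eq_div]
  refine ⟨fun x => f (r⁻¹ • (x - x₀)), by fun_prop, fun x => ⟨f.nonneg, f.le_one⟩, fun x hx => ?_,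
    ?_, fun x => ?_⟩
  · refine f.one_of_mem_closedBall (mem_closedBall_zero_iff.2 ?_)
    rwa [hnorm, div_le_iff₀ hr]
  · have hsub : tsupport (fun x => f (r⁻¹ • (x - x₀))) ⊆
        Metric.closedBall x₀ ((a + b) / 2 * r) := by
      refine closure_minimal (fun x hx => ?_) Metric.isClosed_closedBall
      have hmem : r⁻¹ • (x - x₀) ∈ Function.support f := hx
      rw [f.support_eq, mem_ball_zero_iff, hnorm, div_lt_iff₀ hr] at hmem
      exact hmem.le
    exact hsub.trans (Metric.closedBall_subset_ball (by gcongr; linarith))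
  · rw [fderiv_comp_sub (f := fun y => f (r⁻¹ • y)), fderiv_comp_smul, norm_smul, norm_inv,
      Real.norm_of_nonneg hr.le, div_eq_inv_mul]
    gcongr
    exact (hL _).trans (le_max_left _ _)

end Cutoff

section RelativeCapacity

variable {N : ℕ} {S T U V : Set (EuclideanSpace ℝ (Fin N))} {φ : EuclideanSpace ℝ (Fin N) → ℝ}

theorem mem_testFunctions_of_tsupport_subset_ball {x₀ : EuclideanSpace ℝ (Fin N)} {R : ℝ}
    (hφ : ContDiff ℝ (⊤ : ℕ∞) φ) (hts : tsupport φ ⊆ Metric.ball x₀ R) :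
    φ ∈ testFunctions (Metric.ball x₀ R) :=
  ⟨hφ, (isCompact_closedBall x₀ R).of_isClosed_subset (isClosed_tsupport φ)
    (hts.trans Metric.ball_subset_closedBall), hts⟩

theorem contDiff_one_of_mem_testFunctions (hφ : φ ∈ testFunctions U) : ContDiff ℝ 1 φ :=
  hφ.1.of_le (by exact_mod_cast le_top)

theorem lintegral_enorm_fderiv_lt_top (hφ : φ ∈ testFunctions U) :
    ∫⁻ x, ‖fderiv ℝ φ x‖ₑ < ⊤ :=
  (((contDiff_one_of_mem_testFunctions hφ).continuous_fderiv
    one_ne_zero).integrable_of_hasCompactSupport (hφ.2.1.fderiv (𝕜 := ℝ))).2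

theorem enorm_gradient {F : Type*} [NormedAddCommGroup F] [InnerProductSpace ℝ F] [CompleteSpace F]
    (φ : F → ℝ) (x : F) : ‖gradient φ x‖ₑ = ‖fderiv ℝ φ x‖ₑ := by
  rw [gradient, LinearIsometryEquiv.enorm_map]

theorem relCap_one (S U : Set (EuclideanSpace ℝ (Fin N))) :
    relCap 1 S U = ⨅ φ ∈ {φ ∈ testFunctions U | ∀ x ∈ S, 1 ≤ φ x}, ∫⁻ x, ‖fderiv ℝ φ x‖ₑ := by
  rw [relCap]
  refine iInf_congr fun φ => iInf_congr fun hφ => ?_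
  simp_rw [enorm_gradient, ENNReal.rpow_one]
  exact setLIntegral_enorm_fderiv _ hφ.1.2.2

theorem relCap_one_le (hφ : φ ∈ testFunctions U) (h1 : ∀ x ∈ S, 1 ≤ φ x) :
    relCap 1 S U ≤ ∫⁻ x, ‖fderiv ℝ φ x‖ₑ := by
  rw [relCap_one]
  exact iInf₂_le φ ⟨hφ, h1⟩

theorem le_mul_relCap_one {a c : ℝ≥0∞} (h0 : c ≠ 0) (htop : c ≠ ⊤)
    (h : ∀ φ ∈ testFunctions U, (∀ x ∈ S, 1 ≤ φ x) → a ≤ c * ∫⁻ x, ‖fderiv ℝ φ x‖ₑ) :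
    a ≤ c * relCap 1 S U := by
  simp_rw [relCap_one, ENNReal.mul_iInf_of_ne h0 htop]
  exact le_iInf₂ fun φ hφ => h φ hφ.1 hφ.2

theorem relCap_one_mono (hST : S ⊆ T) (hVU : V ⊆ U) : relCap 1 S U ≤ relCap 1 T V := by
  simp_rw [relCap_one]
  exact biInf_mono fun φ hφ =>
    ⟨⟨hφ.1.1, hφ.1.2.1, hφ.1.2.2.trans hVU⟩, fun x hx => hφ.2 x (hST hx)⟩

theorem volume_le_mul_relCap_one [NeZero N] (S : Set (EuclideanSpace ℝ (Fin N)))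
    (x₀ : EuclideanSpace ℝ (Fin N)) {R : ℝ} (hR : 0 < R) :
    volume S ≤ ENNReal.ofReal (2 * R) * relCap 1 S (Metric.ball x₀ R) := by
  refine le_mul_relCap_one (by simpa using hR) ENNReal.ofReal_ne_top fun φ hφ hφS => ?_
  have hφ1 := contDiff_one_of_mem_testFunctions hφ
  calc volume S ≤ volume {x | 1 ≤ ‖φ x‖ₑ} := by
        refine measure_mono fun x hx => ?_
        rw [mem_ofPred_eq, Real.enorm_eq_ofReal_abs, ENNReal.one_le_ofReal]
        exact (hφS x hx).trans (le_abs_self _)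
    _ ≤ ∫⁻ x, ‖φ x‖ₑ := by
        simpa using mul_meas_ge_le_lintegral hφ1.continuous.enorm.measurable 1
    _ ≤ _ := lintegral_enorm_le_of_tsupport_subset_ball volume hφ1 hR hφ.2.2

theorem relCap_one_closedBall_ne_zero [NeZero N] (x₀ : EuclideanSpace ℝ (Fin N)) {a b : ℝ}
    (ha : 0 < a) (hb : 0 < b) : relCap 1 (Metric.closedBall x₀ a) (Metric.ball x₀ b) ≠ 0 := by
  intro h
  have hvol := volume_le_mul_relCap_one (Metric.closedBall x₀ a) x₀ hb
  rw [h, mul_zero] at hvol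
  exact (Metric.measure_closedBall_pos volume x₀ ha).not_ge hvol

theorem relCap_one_closedBall_ne_top (x₀ : EuclideanSpace ℝ (Fin N)) {a b : ℝ}
    (ha : 0 < a) (hab : a < b) :
    relCap 1 (Metric.closedBall x₀ a) (Metric.ball x₀ b) ≠ ⊤ := by
  obtain ⟨_, -, hcut⟩ := exists_cutoff (EuclideanSpace ℝ (Fin N)) ha hab
  obtain ⟨η, hη, -, hη1, hηs, -⟩ := hcut x₀ 1 one_pos
  rw [mul_one] at hη1 hηs
  have hη_mem := mem_testFunctions_of_tsupport_subset_ball hη hηs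
  exact ((relCap_one_le hη_mem fun x hx => (hη1 x hx).ge).trans_lt
    (lintegral_enorm_fderiv_lt_top hη_mem)).ne

theorem relCap_one_closedBall_mul_le (x₀ x₁ : EuclideanSpace ℝ (Fin N)) (s t : ℝ) {ρ : ℝ}
    (hρ : 0 < ρ) :
    relCap 1 (Metric.closedBall x₁ (ρ * s)) (Metric.ball x₁ (ρ * t)) ≤
      ENNReal.ofReal (ρ ^ N / ρ) * relCap 1 (Metric.closedBall x₀ s) (Metric.ball x₀ t) := by
  have hpos : 0 < ρ ^ N / ρ := by positivity
  refine le_mul_relCap_one (by simpa using hpos) ENNReal.ofReal_ne_top fun φ hφ hφ1 => ?_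
  let f : EuclideanSpace ℝ (Fin N) → EuclideanSpace ℝ (Fin N) := fun x => ρ⁻¹ • (x - x₁) + x₀
  have hf (x) : dist (f x) x₀ = dist x x₁ / ρ := by
    rw [dist_eq_norm, dist_eq_norm, add_sub_cancel_right, norm_smul, norm_inv,
      Real.norm_of_nonneg hρ.le, inv_mul_eq_div]
  have hfc : Continuous f := by fun_prop
  have hts : tsupport (φ ∘ f) ⊆ Metric.ball x₁ (ρ * t) := fun x hx => by
    have := Metric.mem_ball.1 (hφ.2.2 (tsupport_comp_subset_preimage φ hfc hx))
    rwa [hf, div_lt_iff₀' hρ] at this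
  have hmem : φ ∘ f ∈ testFunctions (Metric.ball x₁ (ρ * t)) :=
    mem_testFunctions_of_tsupport_subset_ball (hφ.1.comp (by fun_prop)) hts
  have hfd (x) : ‖fderiv ℝ (φ ∘ f) x‖ₑ = ENNReal.ofReal ρ⁻¹ * ‖fderiv ℝ φ (f x)‖ₑ := by
    change ‖fderiv ℝ (fun x => φ (ρ⁻¹ • (x - x₁) + x₀)) x‖ₑ = _
    rw [fderiv_comp_sub (f := fun y => φ (ρ⁻¹ • y + x₀)),
      fderiv_comp_smul (f := fun y => φ (y + x₀)), fderiv_comp_add_right, enorm_smul,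
      Real.enorm_of_nonneg (by positivity)]
  calc relCap 1 (Metric.closedBall x₁ (ρ * s)) (Metric.ball x₁ (ρ * t))
      ≤ ∫⁻ x, ‖fderiv ℝ (φ ∘ f) x‖ₑ := relCap_one_le hmem fun x hx => hφ1 _ <| by
        rw [Metric.mem_closedBall, hf, div_le_iff₀' hρ]
        exact hx
    _ = ENNReal.ofReal ρ⁻¹ * (ENNReal.ofReal (((ρ⁻¹) ^ N)⁻¹) * ∫⁻ x, ‖fderiv ℝ φ x‖ₑ) := by
        simp_rw [hfd]
        rw [lintegral_const_mul' _ _ ENNReal.ofReal_ne_top,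
          lintegral_sub_right_eq_self (fun y => ‖fderiv ℝ φ (ρ⁻¹ • y + x₀)‖ₑ) x₁,
          lintegral_comp_smul volume (fun y => ‖fderiv ℝ φ (y + x₀)‖ₑ) (inv_pos.2 hρ),
          lintegral_add_right_eq_self (fun y => ‖fderiv ℝ φ y‖ₑ) x₀, finrank_euclideanSpace_fin]
    _ = ENNReal.ofReal (ρ ^ N / ρ) * ∫⁻ x, ‖fderiv ℝ φ x‖ₑ := by
        rw [← mul_assoc, ← ENNReal.ofReal_mul (by positivity), inv_pow, inv_inv, inv_mul_eq_div]

theorem relCap_one_closedBall_mul (x₀ x₁ : EuclideanSpace ℝ (Fin N)) (s t : ℝ) {ρ : ℝ}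
    (hρ : 0 < ρ) :
    relCap 1 (Metric.closedBall x₁ (ρ * s)) (Metric.ball x₁ (ρ * t)) =
      ENNReal.ofReal (ρ ^ N / ρ) * relCap 1 (Metric.closedBall x₀ s) (Metric.ball x₀ t) := by
  refine le_antisymm (relCap_one_closedBall_mul_le x₀ x₁ s t hρ) ?_
  have h := relCap_one_closedBall_mul_le x₁ x₀ (ρ * s) (ρ * t) (inv_pos.2 hρ)
  rw [inv_mul_cancel_left₀ hρ.ne', inv_mul_cancel_left₀ hρ.ne'] at h
  refine (mul_le_mul_right h _).trans ?_
  rw [← mul_assoc, ← ENNReal.ofReal_mul (by positivity), inv_pow,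
    show ρ ^ N / ρ * ((ρ ^ N)⁻¹ / ρ⁻¹) = 1 by field_simp, ENNReal.ofReal_one, one_mul]

end RelativeCapacity

section Dilation

theorem enorm_fderiv_mul_add_one_sub_mul_le {E : Type*} [NormedAddCommGroup E] [NormedSpace ℝ E]
    {χ f g : E → ℝ} {x : E} {L : ℝ} (hχ : DifferentiableAt ℝ χ x) (hχ01 : χ x ∈ Icc (0 : ℝ) 1)
    (hL : ‖fderiv ℝ χ x‖ ≤ L) (hf : DifferentiableAt ℝ f x) (hg : DifferentiableAt ℝ g x) :
    ‖fderiv ℝ (fun x => χ x * f x + (1 - χ x) * g x) x‖ₑ ≤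
      ENNReal.ofReal (χ x) * ‖fderiv ℝ f x‖ₑ + ENNReal.ofReal (1 - χ x) * ‖fderiv ℝ g x‖ₑ +
        ENNReal.ofReal L * ‖f x - g x‖ₑ := by
  have hfd : fderiv ℝ (fun x => χ x * f x + (1 - χ x) * g x) x =
      χ x • fderiv ℝ f x + (1 - χ x) • fderiv ℝ g x + (f x - g x) • fderiv ℝ χ x := by
    rw [fderiv_fun_add (hχ.fun_mul hf) ((hχ.const_sub 1).fun_mul hg), fderiv_fun_mul hχ hf,
      fderiv_fun_mul (hχ.const_sub 1) hg, fderiv_const_sub]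
    module
  rw [hfd, ← Real.enorm_of_nonneg hχ01.1, ← Real.enorm_of_nonneg (sub_nonneg.2 hχ01.2),
    mul_comm (ENNReal.ofReal L)]
  refine (enorm_add₃_le (E := E →L[ℝ] ℝ)).trans (add_le_add (add_le_add ?_ ?_) ?_)
  · rw [enorm_smul]
  · rw [enorm_smul]
  · rw [enorm_smul, ← ofReal_norm (fderiv ℝ χ x)]
    gcongr

variable {E : Type*} [NormedAddCommGroup E] [NormedSpace ℝ E] [FiniteDimensional ℝ E]
  [MeasurableSpace E] [BorelSpace E] (μ : Measure E) [μ.IsAddHaarMeasure]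

theorem lintegral_mul_comp_smul_le {χ : E → ℝ} {g : E → ℝ≥0∞} {R L l : ℝ}
    (hχ : Differentiable ℝ χ) (hχL : ∀ x, ‖fderiv ℝ χ x‖ ≤ L)
    (hg : Function.support g ⊆ Metric.closedBall 0 R) (hl : 0 < l) (hl1 : l ≤ 1) :
    ∫⁻ x, ENNReal.ofReal (χ x) * g (l • x) ∂μ ≤ ENNReal.ofReal ((l ^ Module.finrank ℝ E)⁻¹) *
      ∫⁻ x, ENNReal.ofReal (χ x + L * R * (1 - l) / l) * g x ∂μ := by
  have h := lintegral_comp_smul μ (fun x => ENNReal.ofReal (χ (l⁻¹ • x)) * g x) hl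
  simp only [inv_smul_smul₀ hl.ne'] at h
  rw [h]
  refine mul_le_mul_right (lintegral_mono fun x => ?_) _
  rcases eq_or_ne (g x) 0 with h0 | h0
  · simp [h0]
  have hL : 0 ≤ L := (norm_nonneg _).trans (hχL x)
  have hxR : ‖x‖ ≤ R := mem_closedBall_zero_iff.1 (hg h0)
  have hdist : ‖l⁻¹ • x - x‖ ≤ R * (1 - l) / l := by
    rw [show l⁻¹ • x - x = ((1 - l) / l) • x by rw [sub_div, div_self hl.ne', one_div]; module,
      norm_smul, Real.norm_of_nonneg (div_nonneg (by linarith) hl.le), mul_div_assoc, mul_comm]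
    exact mul_le_mul_of_nonneg_right hxR (div_nonneg (by linarith) hl.le)
  have hlip : χ (l⁻¹ • x) - χ x ≤ L * (R * (1 - l) / l) :=
    (le_abs_self _).trans <| (convex_univ.norm_image_sub_le_of_norm_fderiv_le (𝕜 := ℝ)
      (fun y _ => hχ y) (fun y _ => hχL y) (mem_univ x) (mem_univ (l⁻¹ • x))).trans <|
      mul_le_mul_of_nonneg_left hdist hL
  gcongr
  rw [mul_assoc, mul_div_assoc]
  linarith

theorem lintegral_mul_comp_smul_add_le {χ : E → ℝ} {g : E → ℝ≥0∞} {R L l : ℝ}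
    (hχ : ContDiff ℝ 1 χ) (hχ01 : ∀ x, χ x ∈ Icc (0 : ℝ) 1) (hχL : ∀ x, ‖fderiv ℝ χ x‖ ≤ L)
    (hgm : Measurable g) (hR : 0 ≤ R) (hg : Function.support g ⊆ Metric.closedBall 0 R)
    (hl : 0 < l) (hl1 : l ≤ 1) :
    (∫⁻ x, ENNReal.ofReal (χ x) * g (l • x) ∂μ) + ∫⁻ x, ENNReal.ofReal (1 - χ x) * g x ∂μ ≤
      ENNReal.ofReal ((l ^ Module.finrank ℝ E)⁻¹) *
        (ENNReal.ofReal (1 + L * R * (1 - l) / l) * ∫⁻ x, g x ∂μ) := by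
  have hL : 0 ≤ L := (norm_nonneg _).trans (hχL 0)
  have hδ : 0 ≤ L * R * (1 - l) / l :=
    div_nonneg (mul_nonneg (by positivity) (by linarith)) hl.le
  have hκ : 1 ≤ ENNReal.ofReal ((l ^ Module.finrank ℝ E)⁻¹) := by
    rw [ENNReal.one_le_ofReal]
    exact (one_le_inv₀ (by positivity)).2 (pow_le_one₀ hl.le hl1)
  have hmχ := hχ.continuous.measurable
  have hdil := lintegral_mul_comp_smul_le μ (hχ.differentiable one_ne_zero) hχL hg hl hl1
  refine (add_le_add hdil (le_mul_of_one_le_left' hκ)).trans_eq ?_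
  rw [← mul_add, ← lintegral_add_left (by fun_prop),
    ← lintegral_const_mul' (ENNReal.ofReal (1 + _)) _ ENNReal.ofReal_ne_top]
  congr 1
  refine lintegral_congr fun x => ?_
  rw [← add_mul, ← ENNReal.ofReal_add (add_nonneg (hχ01 x).1 hδ) (sub_nonneg.2 (hχ01 x).2)]
  congr 2
  ring

theorem lintegral_enorm_fderiv_interpolate_dilate_le {χ φ : E → ℝ} {R L l : ℝ}
    (hχ : ContDiff ℝ 1 χ) (hχ01 : ∀ x, χ x ∈ Icc (0 : ℝ) 1) (hχL : ∀ x, ‖fderiv ℝ χ x‖ ≤ L)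
    (hφ : ContDiff ℝ 1 φ) (hR : 0 ≤ R) (hφR : tsupport φ ⊆ Metric.closedBall 0 R)
    (hl : 0 < l) (hl1 : l ≤ 1) :
    ∫⁻ x, ‖fderiv ℝ (fun x => χ x * φ (l • x) + (1 - χ x) * φ x) x‖ₑ ∂μ ≤
      ENNReal.ofReal ((1 + 2 * (L * R * (1 - l) / l)) * (l ^ Module.finrank ℝ E)⁻¹) *
        ∫⁻ x, ‖fderiv ℝ φ x‖ₑ ∂μ := by
  set D := ∫⁻ x, ‖fderiv ℝ φ x‖ₑ ∂μ
  set κ := ENNReal.ofReal ((l ^ Module.finrank ℝ E)⁻¹)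
  set δ := L * R * (1 - l) / l with hδ
  have hL : 0 ≤ L := (norm_nonneg _).trans (hχL 0)
  have hδ0 : 0 ≤ δ := div_nonneg (mul_nonneg (by positivity) (by linarith)) hl.le
  have hdχ := hχ.differentiable one_ne_zero
  have hmχ := hχ.continuous.measurable
  have hdφ := hφ.differentiable one_ne_zero
  have hcφ : Continuous (fderiv ℝ φ) := hφ.continuous_fderiv one_ne_zero
  have hpt (x : E) : ‖fderiv ℝ (fun x => χ x * φ (l • x) + (1 - χ x) * φ x) x‖ₑ ≤
      ENNReal.ofReal (χ x) * ‖fderiv ℝ φ (l • x)‖ₑ + ENNReal.ofReal (1 - χ x) * ‖fderiv ℝ φ x‖ₑ +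
        ENNReal.ofReal L * ‖φ (l • x) - φ x‖ₑ := by
    refine (enorm_fderiv_mul_add_one_sub_mul_le (hdχ x) (hχ01 x) (hχL x)
      (f := fun x => φ (l • x)) (by fun_prop) (hdφ x)).trans ?_
    gcongr
    rw [fderiv_comp_smul, enorm_smul, Real.enorm_of_nonneg hl.le]
    exact mul_le_of_le_one_left' (ENNReal.ofReal_le_one.2 hl1)
  have hdil : ENNReal.ofReal L * ∫⁻ x, ‖φ (l • x) - φ x‖ₑ ∂μ ≤ κ * (ENNReal.ofReal δ * D) := by
    refine (mul_le_mul_right (lintegral_enorm_dilate_sub_le μ hφ hR hφR hl hl1) _).trans_eq ?_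
    rw [ENNReal.ofReal_mul' (by positivity), hδ, show L * R * (1 - l) / l = L * ((1 - l) * (R / l))
      by ring, ENNReal.ofReal_mul hL]
    ring
  calc _ ≤ ∫⁻ x, (ENNReal.ofReal (χ x) * ‖fderiv ℝ φ (l • x)‖ₑ +
          ENNReal.ofReal (1 - χ x) * ‖fderiv ℝ φ x‖ₑ +
          ENNReal.ofReal L * ‖φ (l • x) - φ x‖ₑ) ∂μ := lintegral_mono hpt
    _ ≤ κ * (ENNReal.ofReal (1 + δ) * D) + κ * (ENNReal.ofReal δ * D) := by
        rw [lintegral_add_left (by fun_prop), lintegral_add_left (by fun_prop),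
          lintegral_const_mul' _ _ (by finiteness)]
        exact add_le_add (lintegral_mul_comp_smul_add_le μ hχ hχ01 hχL hcφ.enorm.measurable hR
          ((support_enorm_fderiv_subset φ).trans hφR) hl hl1) hdil
    _ = ENNReal.ofReal ((1 + 2 * δ) * (l ^ Module.finrank ℝ E)⁻¹) * D := by
        rw [← mul_add, ← add_mul, ← ENNReal.ofReal_add (by positivity) hδ0,
          ENNReal.ofReal_mul (by positivity), show 1 + δ + δ = 1 + 2 * δ by ring]
        ring

end Dilation

theorem exists_relCap_one_closedBall_le_shrink (N : ℕ) {a b : ℝ} (ha : 0 < a) (hab : a < b) :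
    ∃ M : ℝ, 0 < M ∧ ∀ l : ℝ, 0 < l → l ≤ 1 →
      relCap 1 (Metric.closedBall (0 : EuclideanSpace ℝ (Fin N)) a) (Metric.ball 0 b) ≤
        ENNReal.ofReal ((1 + M * (1 - l) / l) * (l ^ N)⁻¹) *
          relCap 1 (Metric.closedBall (0 : EuclideanSpace ℝ (Fin N)) (l * a))
            (Metric.ball 0 b) := by
  obtain ⟨L, hL, hcut⟩ := exists_cutoff (EuclideanSpace ℝ (Fin N)) ha hab
  obtain ⟨χ, hχ, hχ01, hχ1, hχs, hχL⟩ := hcut 0 1 one_pos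
  rw [mul_one] at hχ1 hχs
  have hb : 0 < b := ha.trans hab
  refine ⟨2 * L * b, by positivity, fun l hl hl1 => ?_⟩
  have hpos : 0 < (1 + 2 * L * b * (1 - l) / l) * (l ^ N)⁻¹ :=
    mul_pos (add_pos_of_pos_of_nonneg one_pos
      (div_nonneg (mul_nonneg (by positivity) (by linarith)) hl.le)) (by positivity)
  refine le_mul_relCap_one (by simpa using hpos) ENNReal.ofReal_ne_top fun φ hφ hφ1 => ?_
  have := hχ.continuous
  have hψ : ContDiff ℝ (⊤ : ℕ∞) fun x => χ x * φ (l • x) + (1 - χ x) * φ x := by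
    have := hφ.1
    fun_prop
  have hψs : tsupport (fun x => χ x * φ (l • x) + (1 - χ x) * φ x) ⊆ Metric.ball 0 b :=
    (tsupport_add _ _).trans <| union_subset (tsupport_mul_subset_left.trans hχs)
      (tsupport_mul_subset_right.trans hφ.2.2)
  refine (relCap_one_le (mem_testFunctions_of_tsupport_subset_ball hψ hψs) fun x hx => ?_).trans ?_
  · have hlx : l • x ∈ Metric.closedBall (0 : EuclideanSpace ℝ (Fin N)) (l * a) := by
      rw [mem_closedBall_zero_iff, norm_smul, Real.norm_of_nonneg hl.le]
      exact mul_le_mul_of_nonneg_left (mem_closedBall_zero_iff.1 hx) hl.le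
    simpa [hχ1 x hx] using hφ1 _ hlx
  · have h := lintegral_enorm_fderiv_interpolate_dilate_le volume
      (hχ.of_le (by exact_mod_cast le_top)) hχ01 hχL (contDiff_one_of_mem_testFunctions hφ) hb.le
      (hφ.2.2.trans Metric.ball_subset_closedBall) hl hl1
    rw [finrank_euclideanSpace_fin] at h
    refine h.trans_eq ?_
    congr 4
    ring

section Filling

theorem exists_smooth_posPart {ε : ℝ} (hε : 0 < ε) : ∃ T : ℝ → ℝ, ContDiff ℝ (⊤ : ℕ∞) T ∧
    (∀ s, s ≤ T s) ∧ (∀ s, 0 ≤ T s) ∧ (∀ s, T s ≤ max s 0 + ε) ∧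
    ∀ s, deriv T s ∈ Icc (0 : ℝ) 1 := by
  have hpos (s : ℝ) : 0 < s ^ 2 + ε ^ 2 := by positivity
  have habs (s : ℝ) : |s| ≤ √(s ^ 2 + ε ^ 2) := Real.abs_le_sqrt (by nlinarith)
  have hder (s : ℝ) : HasDerivAt (fun s => (s + √(s ^ 2 + ε ^ 2)) / 2)
      ((1 + s / √(s ^ 2 + ε ^ 2)) / 2) s := by
    refine (((hasDerivAt_id s).fun_add
      (((hasDerivAt_pow 2 s).add_const (ε ^ 2)).sqrt (hpos s).ne')).div_const 2).congr_deriv ?_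
    rw [pow_one, Nat.cast_ofNat, mul_div_mul_left _ _ two_ne_zero]
  refine ⟨fun s => (s + √(s ^ 2 + ε ^ 2)) / 2, ?_, fun s => ?_, fun s => ?_, fun s => ?_,
    fun s => ?_⟩
  · exact (contDiff_id.add (((contDiff_id.pow 2).add contDiff_const).sqrt
      fun s => (hpos s).ne')).div_const 2
  · linarith [le_abs_self s, habs s]
  · linarith [neg_abs_le s, habs s]
  · have hle : √(s ^ 2 + ε ^ 2) ≤ |s| + ε :=
      Real.sqrt_le_iff.2 ⟨by positivity, by nlinarith [sq_abs s, abs_nonneg s]⟩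
    rcases abs_cases s with h | h <;> rcases max_cases s 0 with h' | h' <;> linarith
  · have hquot : |s / √(s ^ 2 + ε ^ 2)| ≤ 1 := by
      rw [abs_div, abs_of_nonneg (Real.sqrt_nonneg _)]
      exact div_le_one_of_le₀ (habs s) (Real.sqrt_nonneg _)
    rw [(hder s).deriv]
    constructor <;> linarith [abs_le.1 hquot]

theorem enorm_fderiv_add_mul_comp_one_sub_le {E : Type*} [NormedAddCommGroup E] [NormedSpace ℝ E]
    {φ θ : E → ℝ} {T : ℝ → ℝ} {x : E} {L : ℝ} (hφ : DifferentiableAt ℝ φ x)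
    (hθ : DifferentiableAt ℝ θ x) (hθ01 : θ x ∈ Icc (0 : ℝ) 1) (hL : ‖fderiv ℝ θ x‖ ≤ L)
    (hT : DifferentiableAt ℝ T (1 - φ x)) (hT0 : 0 ≤ T (1 - φ x))
    (hT01 : deriv T (1 - φ x) ∈ Icc (0 : ℝ) 1) :
    ‖fderiv ℝ (fun x => φ x + θ x * T (1 - φ x)) x‖ₑ ≤
      ‖fderiv ℝ φ x‖ₑ + ENNReal.ofReal L * ENNReal.ofReal (T (1 - φ x)) := by
  have hTφ : HasFDerivAt (fun x => T (1 - φ x)) (deriv T (1 - φ x) • -fderiv ℝ φ x) x :=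
    hT.hasDerivAt.comp_hasFDerivAt x (hφ.hasFDerivAt.const_sub 1)
  have hfd : fderiv ℝ (fun x => φ x + θ x * T (1 - φ x)) x =
      (1 - θ x * deriv T (1 - φ x)) • fderiv ℝ φ x + T (1 - φ x) • fderiv ℝ θ x := by
    rw [(hφ.hasFDerivAt.fun_add (hθ.hasFDerivAt.fun_mul hTφ)).fderiv]
    module
  have hcoef : |1 - θ x * deriv T (1 - φ x)| ≤ 1 := by
    rw [abs_le]
    constructor <;> nlinarith [hθ01.1, hθ01.2, hT01.1, hT01.2]
  rw [hfd, ← Real.enorm_of_nonneg hT0, mul_comm (ENNReal.ofReal L)]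
  refine (enorm_add_le (E := E →L[ℝ] ℝ) _ _).trans (add_le_add ?_ ?_)
  · rw [enorm_smul, Real.enorm_eq_ofReal_abs]
    exact mul_le_of_le_one_left' (ENNReal.ofReal_le_one.2 hcoef)
  · rw [enorm_smul, ← ofReal_norm (fderiv ℝ θ x)]
    gcongr

variable {N : ℕ}

theorem relCap_one_le_add_setLIntegral_comp {S U : Set (EuclideanSpace ℝ (Fin N))}
    {φ θ : EuclideanSpace ℝ (Fin N) → ℝ} {T : ℝ → ℝ} {L : ℝ} (hφ : φ ∈ testFunctions U)
    (hθ : θ ∈ testFunctions U) (hθ01 : ∀ x, θ x ∈ Icc (0 : ℝ) 1) (hθ1 : ∀ x ∈ S, θ x = 1)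
    (hL : ∀ x, ‖fderiv ℝ θ x‖ ≤ L) (hT : ContDiff ℝ (⊤ : ℕ∞) T) (hTs : ∀ s, s ≤ T s)
    (hT0 : ∀ s, 0 ≤ T s) (hT01 : ∀ s, deriv T s ∈ Icc (0 : ℝ) 1) :
    relCap 1 S U ≤ (∫⁻ x, ‖fderiv ℝ φ x‖ₑ) +
      ENNReal.ofReal L * ∫⁻ x in tsupport θ, ENNReal.ofReal (T (1 - φ x)) := by
  have hcφ : Continuous (fderiv ℝ φ) := hφ.1.continuous_fderiv (by simp)
  have hψs : tsupport (fun x => φ x + θ x * T (1 - φ x)) ⊆ tsupport φ ∪ tsupport θ :=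
    (tsupport_add _ _).trans (union_subset_union_right _ tsupport_mul_subset_left)
  have hψ : (fun x => φ x + θ x * T (1 - φ x)) ∈ testFunctions U :=
    ⟨hφ.1.add (hθ.1.mul (hT.comp (contDiff_const.sub hφ.1))),
      (hφ.2.1.isCompact.union hθ.2.1.isCompact).of_isClosed_subset (isClosed_tsupport _) hψs,
      hψs.trans (union_subset hφ.2.2 hθ.2.2)⟩
  have hgrad (x) : ‖fderiv ℝ (fun x => φ x + θ x * T (1 - φ x)) x‖ₑ ≤ ‖fderiv ℝ φ x‖ₑ +
      ENNReal.ofReal L * (tsupport θ).indicator (fun x => ENNReal.ofReal (T (1 - φ x))) x := by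
    by_cases hx : x ∈ tsupport θ
    · rw [indicator_of_mem hx]
      exact enorm_fderiv_add_mul_comp_one_sub_le (hφ.1.differentiable (by simp) x)
        (hθ.1.differentiable (by simp) x) (hθ01 x) (hL x) (hT.differentiable (by simp) _)
        (hT0 _) (hT01 _)
    · have heq : (fun x => φ x + θ x * T (1 - φ x)) =ᶠ[𝓝 x] φ := by
        filter_upwards [notMem_tsupport_iff_eventuallyEq.1 hx] with y hy
        simp [hy]
      simp [heq.fderiv_eq, hx]
  refine (relCap_one_le hψ fun x hx => ?_).trans ((lintegral_mono hgrad).trans_eq ?_)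
  · rw [hθ1 x hx, one_mul]
    linarith [hTs (1 - φ x)]
  · rw [lintegral_add_left hcφ.enorm.measurable, lintegral_const_mul' _ _ ENNReal.ofReal_ne_top,
      lintegral_indicator (isClosed_tsupport θ).measurableSet]

theorem relCap_one_le_add_setLIntegral {S U : Set (EuclideanSpace ℝ (Fin N))}
    {φ θ : EuclideanSpace ℝ (Fin N) → ℝ} {L : ℝ} (hφ : φ ∈ testFunctions U)
    (hθ : θ ∈ testFunctions U) (hθ01 : ∀ x, θ x ∈ Icc (0 : ℝ) 1) (hθ1 : ∀ x ∈ S, θ x = 1)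
    (hL : ∀ x, ‖fderiv ℝ θ x‖ ≤ L) :
    relCap 1 S U ≤ (∫⁻ x, ‖fderiv ℝ φ x‖ₑ) +
      ENNReal.ofReal L * ∫⁻ x in tsupport θ, ENNReal.ofReal (1 - φ x) := by
  have hvol : volume (tsupport θ) ≠ ⊤ := hθ.2.1.measure_lt_top.ne
  let B (ε : ℝ) : ℝ≥0∞ := (∫⁻ x, ‖fderiv ℝ φ x‖ₑ) + ENNReal.ofReal L *
    ((∫⁻ x in tsupport θ, ENNReal.ofReal (1 - φ x)) + ENNReal.ofReal ε * volume (tsupport θ))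
  have hB (ε : ℝ) (hε : ε ∈ Ioi (0 : ℝ)) : relCap 1 S U ≤ B ε := by
    obtain ⟨T, hT, hTs, hT0, hTε, hT01⟩ := exists_smooth_posPart hε
    refine (relCap_one_le_add_setLIntegral_comp hφ hθ hθ01 hθ1 hL hT hTs hT0 hT01).trans ?_
    simp only [B]
    rw [← setLIntegral_const, ← lintegral_add_right _ measurable_const]
    gcongr with x
    refine (ENNReal.ofReal_le_ofReal (hTε _)).trans (ENNReal.ofReal_add_le.trans_eq ?_)
    simp
  have hcont : Continuous B := by
    refine continuous_const.add ((ENNReal.continuous_const_mul ENNReal.ofReal_ne_top).comp ?_)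
    exact continuous_const.add ((ENNReal.continuous_mul_const hvol).comp ENNReal.continuous_ofReal)
  simpa [B] using ge_of_tendsto ((hcont.tendsto 0).mono_left nhdsWithin_le_nhds)
    (mem_of_superset self_mem_nhdsWithin hB)

theorem exists_relCap_one_closedBall_le_mul_shrink (N : ℕ) {K : ℝ} (hK : 1 < K) :
    ∃ l ∈ Ioo (0 : ℝ) 1, ∀ (x₀ : EuclideanSpace ℝ (Fin N)) (r : ℝ), 0 < r →
      relCap 1 (Metric.closedBall x₀ r) (Metric.ball x₀ (2 * r)) ≤
        ENNReal.ofReal K * relCap 1 (Metric.closedBall x₀ (l * r)) (Metric.ball x₀ (2 * r)) := by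
  obtain ⟨M, -, hshrink⟩ := exists_relCap_one_closedBall_le_shrink N one_pos one_lt_two
  have hcont : ContinuousAt (fun l : ℝ => (1 + M * (1 - l) / l) * (l ^ N)⁻¹) 1 := by
    fun_prop (disch := simp)
  have hlim : Tendsto (fun l : ℝ => (1 + M * (1 - l) / l) * (l ^ N)⁻¹) (𝓝[<] 1) (𝓝 1) := by
    simpa using hcont.tendsto.mono_left nhdsWithin_le_nhds
  obtain ⟨l, hlK, hl⟩ :=
    ((hlim.eventually_lt_const hK).and (Ioo_mem_nhdsLT (zero_lt_one' ℝ))).exists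
  refine ⟨l, hl, fun x₀ r hr => ?_⟩
  calc relCap 1 (Metric.closedBall x₀ r) (Metric.ball x₀ (2 * r))
      = ENNReal.ofReal (r ^ N / r) *
          relCap 1 (Metric.closedBall (0 : EuclideanSpace ℝ (Fin N)) 1) (Metric.ball 0 2) := by
        rw [← relCap_one_closedBall_mul 0 x₀ _ _ hr, mul_one, mul_comm]
    _ ≤ ENNReal.ofReal (r ^ N / r) * (ENNReal.ofReal K *
          relCap 1 (Metric.closedBall (0 : EuclideanSpace ℝ (Fin N)) l) (Metric.ball 0 2)) := by
        gcongr
        refine (hshrink l hl.1 hl.2.le).trans ?_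
        rw [mul_one]
        gcongr
    _ = _ := by
        rw [mul_left_comm, ← relCap_one_closedBall_mul 0 x₀ _ _ hr, mul_comm r l, mul_comm r 2]

theorem ofReal_mul_le_of_le_mul_add {x y : ℝ≥0∞} {K γ a : ℝ} (hx : x ≠ ⊤) (hK : 0 < K)
    (hγ : 0 ≤ γ) (ha : 0 < a)
    (h : x ≤ ENNReal.ofReal K * (ENNReal.ofReal γ * x + ENNReal.ofReal a * y)) :
    ENNReal.ofReal ((1 - K * γ) / (K * a)) * x ≤ y := by
  rcases eq_or_ne y ⊤ with rfl | hy
  · exact le_top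
  lift x to NNReal using hx
  lift y to NNReal using hy
  simp only [← ENNReal.ofReal_coe_nnreal] at h ⊢
  rw [← ENNReal.ofReal_mul hγ, ← ENNReal.ofReal_mul ha.le,
    ← ENNReal.ofReal_add (by positivity) (by positivity), ← ENNReal.ofReal_mul hK.le,
    ENNReal.ofReal_le_ofReal_iff (by positivity)] at h
  rw [← ENNReal.ofReal_mul' x.coe_nonneg]
  refine ENNReal.ofReal_le_ofReal ?_
  rw [div_mul_eq_mul_div, div_le_iff₀ (by positivity)]
  linarith

theorem exists_mul_relCap_one_le_setLIntegral_one_sub (N : ℕ) {γ : ℝ}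
    (hγ : γ ∈ Ioo (0 : ℝ) 1) :
    ∃ κ ∈ Ioo (0 : ℝ) 1, ∃ m : ℝ, 0 < m ∧ ∀ (x₀ : EuclideanSpace ℝ (Fin N)) (r : ℝ), 0 < r →
      ∀ φ ∈ testFunctions (Metric.ball x₀ (2 * r)),
        ∫⁻ x, ‖fderiv ℝ φ x‖ₑ ≤
          ENNReal.ofReal γ * relCap 1 (Metric.closedBall x₀ r) (Metric.ball x₀ (2 * r)) →
        ENNReal.ofReal (m * r) * relCap 1 (Metric.closedBall x₀ r) (Metric.ball x₀ (2 * r)) ≤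
          ∫⁻ x in Metric.ball x₀ (κ * r), ENNReal.ofReal (1 - φ x) := by
  obtain ⟨K, hK1, hKγ⟩ := exists_between (one_lt_inv_iff₀.2 hγ)
  have hK0 : 0 < K := one_pos.trans hK1
  have hKγ' : 0 < 1 - K * γ := sub_pos.2 ((lt_inv_mul_iff₀' hγ.1).1 (by rwa [mul_one]))
  obtain ⟨l, ⟨hl0, hl1⟩, hshrink⟩ := exists_relCap_one_closedBall_le_mul_shrink N hK1
  obtain ⟨κ, hlκ, hκ1⟩ := exists_between hl1
  obtain ⟨L, hL, hcut⟩ := exists_cutoff (EuclideanSpace ℝ (Fin N)) hl0 hlκ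
  refine ⟨κ, ⟨hl0.trans hlκ, hκ1⟩, (1 - K * γ) / (K * L), by positivity,
    fun x₀ r hr φ hφ hφγ => ?_⟩
  set C := relCap 1 (Metric.closedBall x₀ r) (Metric.ball x₀ (2 * r))
  have hC : C ≠ ⊤ := relCap_one_closedBall_ne_top x₀ hr (by linarith)
  set I := ∫⁻ x in Metric.ball x₀ (κ * r), ENNReal.ofReal (1 - φ x)
  have hle : C ≤ ENNReal.ofReal K * (ENNReal.ofReal γ * C + ENNReal.ofReal (L / r) * I) := by
    obtain ⟨θ, hθ, hθ01, hθ1, hθs, hθL⟩ := hcut x₀ r hr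
    have hθU : θ ∈ testFunctions (Metric.ball x₀ (2 * r)) :=
      mem_testFunctions_of_tsupport_subset_ball hθ
        (hθs.trans (Metric.ball_subset_ball (by gcongr; linarith)))
    refine (hshrink x₀ r hr).trans ?_
    gcongr
    refine (relCap_one_le_add_setLIntegral hφ hθU hθ01 hθ1 hθL).trans ?_
    gcongr
    exact lintegral_mono_set hθs
  rw [show (1 - K * γ) / (K * L) * r = (1 - K * γ) / (K * (L / r)) by field_simp]
  exact ofReal_mul_le_of_le_mul_add hC hK0 hγ.1.le (by positivity) hle

end Filling

section Poincare

theorem enorm_fderiv_mul_const_sub_le {E : Type*} [NormedAddCommGroup E] [NormedSpace ℝ E]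
    {η u : E → ℝ} {x : E} {l : ℝ} (hη : DifferentiableAt ℝ η x) (hu : DifferentiableAt ℝ u x)
    (h01 : η x ∈ Icc (0 : ℝ) 1) (hl : ‖fderiv ℝ η x‖ ≤ l) (c : ℝ) :
    ‖fderiv ℝ (fun x => η x * (c - u x)) x‖ₑ ≤
      ENNReal.ofReal l * ‖c - u x‖ₑ + ‖fderiv ℝ u x‖ₑ := by
  rw [fderiv_fun_mul hη (hu.const_sub c), fderiv_const_sub, add_comm]
  refine (enorm_add_le (E := E →L[ℝ] ℝ) _ _).trans (add_le_add ?_ ?_)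
  · rw [enorm_smul, mul_comm, ← ofReal_norm (fderiv ℝ η x)]
    gcongr
  · rw [enorm_smul, enorm_neg, Real.enorm_of_nonneg h01.1]
    exact mul_le_of_le_one_left' (ENNReal.ofReal_le_one.2 h01.2)

variable {N : ℕ}

theorem enorm_mul_relCap_one_diff_le {S U Ω : Set (EuclideanSpace ℝ (Fin N))}
    {η u : EuclideanSpace ℝ (Fin N) → ℝ} {l : ℝ} (hη : η ∈ testFunctions U)
    (h01 : ∀ x, η x ∈ Icc (0 : ℝ) 1) (hη1 : ∀ x ∈ S, η x = 1) (hl : ∀ x, ‖fderiv ℝ η x‖ ≤ l)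
    (hu : u ∈ testFunctions Ω) (c : ℝ) :
    ‖c‖ₑ * relCap 1 (S \ Ω) U ≤
      ∫⁻ x in U, (ENNReal.ofReal l * ‖c - u x‖ₑ + ‖fderiv ℝ u x‖ₑ) := by
  rcases eq_or_ne c 0 with rfl | hc
  · simp
  let ψ : EuclideanSpace ℝ (Fin N) → ℝ := fun x => η x * (c - u x)
  have hψ : ContDiff ℝ (⊤ : ℕ∞) ψ := hη.1.mul (contDiff_const.sub hu.1)
  have hψs : tsupport ψ ⊆ tsupport η := tsupport_mul_subset_left
  have hcψs : tsupport (fun x => c⁻¹ * ψ x) ⊆ tsupport η :=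
    (tsupport_mul_subset_right (f := fun _ => c⁻¹)).trans hψs
  have hcap : relCap 1 (S \ Ω) U ≤ ∫⁻ x, ‖fderiv ℝ (fun x => c⁻¹ * ψ x) x‖ₑ := by
    refine relCap_one_le ⟨contDiff_const.mul hψ,
      hη.2.1.of_isClosed_subset (isClosed_tsupport _) hcψs, hcψs.trans hη.2.2⟩ fun x hx => ?_
    have hux : u x = 0 := image_eq_zero_of_notMem_tsupport fun h => hx.2 (hu.2.2 h)
    simp [ψ, hη1 x hx.1, hux, hc]
  calc ‖c‖ₑ * relCap 1 (S \ Ω) U ≤ ‖c‖ₑ * ∫⁻ x, ‖fderiv ℝ (fun x => c⁻¹ * ψ x) x‖ₑ := by gcongr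
    _ = ∫⁻ x, ‖fderiv ℝ ψ x‖ₑ := by
        simp_rw [fun x => fderiv_const_mul (hψ.differentiable (by simp) x) c⁻¹, enorm_smul]
        rw [lintegral_const_mul' _ _ enorm_ne_top, ← mul_assoc, ← enorm_mul,
          mul_inv_cancel₀ hc, enorm_one, one_mul]
    _ = ∫⁻ x in U, ‖fderiv ℝ ψ x‖ₑ := (setLIntegral_enorm_fderiv _ (hψs.trans hη.2.2)).symm
    _ ≤ _ := lintegral_mono fun x => enorm_fderiv_mul_const_sub_le
        (hη.1.differentiable (by simp) x) (hu.1.differentiable (by simp) x) (h01 x) (hl x) c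

theorem lintegral_setLIntegral_translate_le {E : Type*} [NormedAddCommGroup E] [NormedSpace ℝ E]
    [FiniteDimensional ℝ E] [MeasurableSpace E] [BorelSpace E] (μ : Measure E) [μ.IsAddHaarMeasure]
    {u : E → ℝ} (hu : ContDiff ℝ 1 u) {l R : ℝ} (hl : 0 ≤ l)
    (hR : 0 ≤ R) :
    ∫⁻ y, ∫⁻ h in Metric.ball 0 R,
        (ENNReal.ofReal l * ‖u y - u (y + h)‖ₑ + ‖fderiv ℝ u (y + h)‖ₑ) ∂μ ∂μ ≤
      ENNReal.ofReal (l * R + 1) * (∫⁻ x, ‖fderiv ℝ u x‖ₑ ∂μ) * μ (Metric.ball 0 R) := by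
  have hfu : Continuous (fderiv ℝ u) := hu.continuous_fderiv one_ne_zero
  have hmeas : Measurable fun p : E × E =>
      ENNReal.ofReal l * ‖u p.1 - u (p.1 + p.2)‖ₑ + ‖fderiv ℝ u (p.1 + p.2)‖ₑ := by
    have hc := hu.continuous
    have h1 : Continuous fun p : E × E => u p.1 - u (p.1 + p.2) := by fun_prop
    have h2 : Continuous fun p : E × E => fderiv ℝ u (p.1 + p.2) := by fun_prop
    exact (h1.enorm.measurable.const_mul _).add h2.enorm.measurable
  rw [lintegral_lintegral_swap hmeas.aemeasurable, ← setLIntegral_const]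
  refine setLIntegral_mono' measurableSet_ball fun h hh => ?_
  have hhR : ‖h‖ₑ ≤ ENNReal.ofReal R := by
    rw [← ofReal_norm]
    exact ENNReal.ofReal_le_ofReal (mem_ball_zero_iff.1 hh).le
  have hm : Measurable fun y => ‖fderiv ℝ u (y + h)‖ₑ :=
    (hfu.comp (continuous_add_const h)).enorm.measurable
  rw [lintegral_add_right _ hm, lintegral_const_mul' _ _ ENNReal.ofReal_ne_top,
    lintegral_add_right_eq_self (fun x => ‖fderiv ℝ u x‖ₑ) h,
    ENNReal.ofReal_add (by positivity) zero_le_one, ENNReal.ofReal_one, add_mul, one_mul,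
    ENNReal.ofReal_mul hl, mul_assoc]
  simp_rw [fun y => enorm_sub_rev (u y) (u (y + h))]
  gcongr
  exact (lintegral_enorm_translate_sub_le μ hu h).trans (by gcongr)

theorem exists_mul_lintegral_enorm_le_of_le_relCap_one (N : ℕ) : ∃ L : ℝ, 0 < L ∧
    ∀ {Ω : Set (EuclideanSpace ℝ (Fin N))} {a : ℝ≥0∞} {r : ℝ}, 0 < r →
      (∀ y, a ≤ relCap 1 (Metric.closedBall y r \ Ω) (Metric.ball y (2 * r))) →
      ∀ u ∈ testFunctions Ω, a * ∫⁻ x, ‖u x‖ₑ ≤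
        ENNReal.ofReal L * (∫⁻ x, ‖fderiv ℝ u x‖ₑ) *
          volume (Metric.ball (0 : EuclideanSpace ℝ (Fin N)) (2 * r)) := by
  obtain ⟨L, hL, hcut⟩ := exists_cutoff (EuclideanSpace ℝ (Fin N)) one_pos one_lt_two
  refine ⟨2 * L + 1, by positivity, fun {Ω a r} hr ha u hu => ?_⟩
  have hpt (y) : a * ‖u y‖ₑ ≤ ∫⁻ h in Metric.ball 0 (2 * r),
      (ENNReal.ofReal (L / r) * ‖u y - u (y + h)‖ₑ + ‖fderiv ℝ u (y + h)‖ₑ) := by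
    obtain ⟨η, hη, h01, hη1, hηs, hηL⟩ := hcut y r hr
    rw [one_mul] at hη1
    calc a * ‖u y‖ₑ ≤ ‖u y‖ₑ * relCap 1 (Metric.closedBall y r \ Ω) (Metric.ball y (2 * r)) := by
          rw [mul_comm]
          gcongr
          exact ha y
      _ ≤ ∫⁻ x in Metric.ball y (2 * r),
          (ENNReal.ofReal (L / r) * ‖u y - u x‖ₑ + ‖fderiv ℝ u x‖ₑ) :=
          enorm_mul_relCap_one_diff_le (mem_testFunctions_of_tsupport_subset_ball hη hηs) h01 hη1
            hηL hu (u y)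
      _ = _ := by
          rw [← lintegral_indicator measurableSet_ball, ← lintegral_indicator measurableSet_ball,
            ← lintegral_add_left_eq_self _ y]
          refine lintegral_congr fun x => ?_
          simp [indicator, dist_eq_norm]
  have hu1 := contDiff_one_of_mem_testFunctions hu
  rw [← lintegral_const_mul _ hu1.continuous.enorm.measurable]
  refine (lintegral_mono hpt).trans
    ((lintegral_setLIntegral_translate_le volume hu1 (by positivity) (by positivity)).trans_eq ?_)
  rw [show L / r * (2 * r) + 1 = 2 * L + 1 by field_simp]

theorem exists_poincare_const (N : ℕ) [NeZero N] : ∃ K : ℝ, 0 < K ∧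
    ∀ {γ r : ℝ} {Ω : Set (EuclideanSpace ℝ (Fin N))}, 0 < γ → 0 < r →
      (∀ x₀, ENNReal.ofReal γ * relCap 1 (Metric.closedBall x₀ r) (Metric.ball x₀ (2 * r))
        ≤ relCap 1 (Metric.closedBall x₀ r \ Ω) (Metric.ball x₀ (2 * r))) →
      ∀ u ∈ testFunctions Ω,
        ∫⁻ x, ‖u x‖ₑ ≤ ENNReal.ofReal (K * r / γ) * ∫⁻ x, ‖fderiv ℝ u x‖ₑ := by
  obtain ⟨L, hL, hle⟩ := exists_mul_lintegral_enorm_le_of_le_relCap_one N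
  refine ⟨4 * 2 ^ N * L, by positivity, fun {γ r Ω} hγ hr hcap u hu => ?_⟩
  set V := volume (Metric.ball (0 : EuclideanSpace ℝ (Fin N)) r)
  have hV0 : V ≠ 0 := (Metric.measure_ball_pos _ _ hr).ne'
  have hVtop : V ≠ ⊤ := measure_ball_lt_top.ne
  have hlow (y) : ENNReal.ofReal (γ / (4 * r)) * V ≤
      relCap 1 (Metric.closedBall y r \ Ω) (Metric.ball y (2 * r)) := by
    have hvol : V ≤ ENNReal.ofReal (4 * r) *
        relCap 1 (Metric.closedBall y r) (Metric.ball y (2 * r)) :=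
      calc V = volume (Metric.ball y r) := (Measure.addHaar_ball_center volume y r).symm
        _ ≤ volume (Metric.closedBall y r) := measure_mono Metric.ball_subset_closedBall
        _ ≤ ENNReal.ofReal (2 * (2 * r)) * _ := volume_le_mul_relCap_one _ y (by positivity)
        _ = _ := by ring_nf
    refine (mul_le_mul_right hvol _).trans (le_trans (le_of_eq ?_) (hcap y))
    rw [← mul_assoc, ← ENNReal.ofReal_mul (by positivity), div_mul_cancel₀ _ (by positivity)]
  have hint := hle hr hlow u hu
  rw [Measure.addHaar_ball_mul_of_pos _ _ two_pos, finrank_euclideanSpace_fin] at hint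
  have hscaled : ENNReal.ofReal (γ / (4 * r)) * ∫⁻ x, ‖u x‖ₑ ≤
      ENNReal.ofReal (2 ^ N * L) * ∫⁻ x, ‖fderiv ℝ u x‖ₑ := by
    refine (ENNReal.mul_le_mul_iff_left hV0 hVtop).1 ?_
    rw [ENNReal.ofReal_mul (by positivity)]
    convert hint using 1 <;> ring
  have hmul := mul_le_mul_right hscaled (ENNReal.ofReal (4 * r / γ))
  rw [← mul_assoc, ← mul_assoc, ← ENNReal.ofReal_mul (by positivity),
    ← ENNReal.ofReal_mul (by positivity), div_mul_div_cancel₀ hγ.ne', div_self (by positivity),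
    ENNReal.ofReal_one, one_mul] at hmul
  convert hmul using 3
  ring

end Poincare

section Covering

theorem exists_ball_superset {X : Type*} [PseudoMetricSpace X] [Nonempty X] {d : ℕ} (hd : d ≠ 0)
    {t : Set X} {δ : ℝ} (ht : Metric.ediam t < ENNReal.ofReal δ) {ε : ℝ≥0∞} (hε : ε ≠ 0) :
    ∃ x r, 0 < r ∧ r ≤ δ ∧ t ⊆ Metric.ball x r ∧
      ENNReal.ofReal r ^ d ≤ (⨆ _ : t.Nonempty, Metric.ediam t ^ (d : ℝ)) + ε := by
  have htop : Metric.ediam t ≠ ⊤ := ht.ne_top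
  have hδ : (Metric.ediam t).toReal < δ := ENNReal.toReal_lt_of_lt_ofReal ht
  have hsup : Metric.ediam t ^ d ≤ ⨆ _ : t.Nonempty, Metric.ediam t ^ (d : ℝ) := by
    rcases t.eq_empty_or_nonempty with rfl | h
    · simp [hd]
    · simp [h]
  have hlim : Tendsto (fun r => ENNReal.ofReal r ^ d) (𝓝[>] (Metric.ediam t).toReal)
      (𝓝 (Metric.ediam t ^ d)) := by
    simpa [Function.comp_def, ENNReal.ofReal_toReal htop] using
      (((ENNReal.continuous_pow d).comp ENNReal.continuous_ofReal).tendsto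
        (Metric.ediam t).toReal).mono_left nhdsWithin_le_nhds
  obtain ⟨r, hr, hrt, hrδ⟩ :=
    ((hlim.eventually_lt_const (ENNReal.lt_add_right (by finiteness) hε)).and
      (Ioo_mem_nhdsGT hδ)).exists
  have hball : ∃ x, t ⊆ Metric.ball x r := by
    rcases t.eq_empty_or_nonempty with rfl | ⟨x, hx⟩
    · exact ⟨Classical.arbitrary X, empty_subset _⟩
    · refine ⟨x, fun y hy => lt_of_le_of_lt ?_ hrt⟩
      rw [dist_edist]
      exact ENNReal.toReal_mono htop (Metric.edist_le_ediam_of_mem hy hx)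
  obtain ⟨x, hx⟩ := hball
  exact ⟨x, r, ENNReal.toReal_nonneg.trans_lt hrt, hrδ.le, hx, hr.le.trans (by gcongr)⟩

theorem exists_finset_ball_cover_of_hausdorffMeasure_lt {X : Type*} [MetricSpace X]
    [MeasurableSpace X] [BorelSpace X] [Nonempty X] {d : ℕ} (hd : d ≠ 0) {s : Set X}
    (hs : IsCompact s) {a : ℝ≥0∞} (ha : μH[(d : ℝ)] s < a) {δ : ℝ} (hδ : 0 < δ) :
    ∃ (F : Finset ℕ) (x : ℕ → X) (r : ℕ → ℝ), (∀ i, 0 < r i ∧ r i ≤ δ) ∧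
      s ⊆ ⋃ i ∈ F, Metric.ball (x i) (r i) ∧ ∑ i ∈ F, ENNReal.ofReal (r i) ^ d ≤ a := by
  have hδ2 : 0 < ENNReal.ofReal (δ / 2) := ENNReal.ofReal_pos.2 (half_pos hδ)
  have hinf : (⨅ (t : ℕ → Set X) (_ : s ⊆ ⋃ n, t n)
      (_ : ∀ n, Metric.ediam (t n) ≤ ENNReal.ofReal (δ / 2)),
      ∑' n, ⨆ _ : (t n).Nonempty, Metric.ediam (t n) ^ (d : ℝ)) < a := by
    rw [Measure.hausdorffMeasure_apply] at ha
    exact (le_iSup₂_of_le _ hδ2 le_rfl).trans_lt ha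
  simp only [iInf_lt_iff] at hinf
  obtain ⟨t, hst, htδ, hta⟩ := hinf
  obtain ⟨ε, hε, hεsum⟩ := ENNReal.exists_pos_sum_of_countable' (tsub_pos_of_lt hta).ne' ℕ
  choose x r hr hrδ htr hrd using fun n => exists_ball_superset hd
    ((htδ n).trans_lt ((ENNReal.ofReal_lt_ofReal_iff hδ).2 (half_lt_self hδ))) (hε n).ne'
  obtain ⟨F, hF⟩ := hs.elim_finite_subcover _ (fun n => Metric.isOpen_ball)
    (hst.trans (iUnion_mono htr))
  refine ⟨F, x, r, fun n => ⟨hr n, hrδ n⟩, hF, ?_⟩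
  calc ∑ i ∈ F, ENNReal.ofReal (r i) ^ d
      ≤ ∑' i, ENNReal.ofReal (r i) ^ d := ENNReal.sum_le_tsum F
    _ ≤ ∑' i, ((⨆ _ : (t i).Nonempty, Metric.ediam (t i) ^ (d : ℝ)) + ε i) :=
        ENNReal.tsum_le_tsum hrd
    _ ≤ _ + (a - _) := by
        rw [ENNReal.tsum_add]
        gcongr
    _ = a := add_tsub_cancel_of_le hta.le

end Covering

section LowerBound

theorem norm_fderiv_finset_prod_le {𝕜 E ι : Type*} [NontriviallyNormedField 𝕜]
    [NormedAddCommGroup E] [NormedSpace 𝕜 E] {F : Finset ι} {f : ι → E → 𝕜} {x : E}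
    (hf : ∀ i ∈ F, DifferentiableAt 𝕜 (f i) x) (h1 : ∀ i ∈ F, ‖f i x‖ ≤ 1) :
    ‖fderiv 𝕜 (fun x => ∏ i ∈ F, f i x) x‖ ≤ ∑ i ∈ F, ‖fderiv 𝕜 (f i) x‖ := by
  classical
  rw [fderiv_finsetProd hf]
  refine (norm_sum_le _ _).trans (Finset.sum_le_sum fun i _ => ?_)
  rw [norm_smul, norm_prod]
  exact mul_le_of_le_one_left (norm_nonneg _) (Finset.prod_le_one (fun _ _ => norm_nonneg _)
    fun j hj => h1 j (Finset.mem_of_mem_erase hj))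

variable {N d : ℕ}

theorem indicator_mem_testFunctions {G : Set (EuclideanSpace ℝ (Fin N))} (hG : IsOpen G)
    (hGc : IsCompact (closure G)) {ψ : EuclideanSpace ℝ (Fin N) → ℝ}
    (hψ : ContDiff ℝ (⊤ : ℕ∞) ψ) (hzero : ∀ x ∈ frontier G, ψ =ᶠ[𝓝 x] 0) :
    G.indicator ψ ∈ testFunctions G := by
  have hout : ∀ x ∉ G, G.indicator ψ =ᶠ[𝓝 x] 0 := by
    intro x hx
    by_cases hxc : x ∈ closure G
    · filter_upwards [hzero x (hG.frontier_eq ▸ ⟨hxc, hx⟩)] with y hy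
      exact indicator_apply_eq_zero.2 fun _ => hy
    · filter_upwards [isClosed_closure.isOpen_compl.mem_nhds hxc] with y hy
      exact indicator_of_notMem (notMem_subset subset_closure hy) _
  have hts : tsupport (G.indicator ψ) ⊆ G := fun x hx => by
    by_contra hxG
    exact notMem_tsupport_iff_eventuallyEq.2 (hout x hxG) hx
  refine ⟨contDiff_iff_contDiffAt.2 fun x => ?_,
    hGc.of_isClosed_subset (isClosed_tsupport _) (hts.trans subset_closure), hts⟩
  by_cases hx : x ∈ G
  · exact hψ.contDiffAt.congr_of_eventuallyEq
      ((eqOn_indicator (s := G)).eventuallyEq_of_mem (hG.mem_nhds hx))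
  · exact contDiffAt_const.congr_of_eventuallyEq (hout x hx)

theorem indicator_prod_mem_testFunctions {G : Set (EuclideanSpace ℝ (Fin N))} (hG : IsOpen G)
    (hGc : IsCompact (closure G)) {ι : Type*} {F : Finset ι}
    {η : ι → EuclideanSpace ℝ (Fin N) → ℝ} {U : ι → Set (EuclideanSpace ℝ (Fin N))}
    (hη : ∀ i ∈ F, ContDiff ℝ (⊤ : ℕ∞) (η i)) (hU : ∀ i ∈ F, IsOpen (U i))
    (hcov : frontier G ⊆ ⋃ i ∈ F, U i) (h1 : ∀ i ∈ F, ∀ y ∈ U i, η i y = 1) :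
    G.indicator (fun y => ∏ i ∈ F, (1 - η i y)) ∈ testFunctions G := by
  refine indicator_mem_testFunctions hG hGc
    (contDiff_prod fun i hi => contDiff_const.sub (hη i hi)) fun y hy => ?_
  obtain ⟨i, hi, hyi⟩ := mem_iUnion₂.1 (hcov hy)
  filter_upwards [(hU i hi).mem_nhds hyi] with z hz
  exact Finset.prod_eq_zero hi (by rw [h1 i hi z hz, sub_self])

theorem norm_fderiv_indicator_le {𝕜 E F : Type*} [NontriviallyNormedField 𝕜]
    [NormedAddCommGroup E] [NormedSpace 𝕜 E] [NormedAddCommGroup F] [NormedSpace 𝕜 F] {G : Set E}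
    (hG : IsOpen G) {ψ : E → F} (hts : tsupport (G.indicator ψ) ⊆ G) (x : E) :
    ‖fderiv 𝕜 (G.indicator ψ) x‖ ≤ ‖fderiv 𝕜 ψ x‖ := by
  by_cases hx : x ∈ G
  · rw [((eqOn_indicator (s := G)).eventuallyEq_of_mem (hG.mem_nhds hx)).fderiv_eq]
  · rw [Function.notMem_support.1 fun h => hx (hts (support_fderiv_subset 𝕜 h)), norm_zero]
    exact norm_nonneg _

theorem volume_ball_two_mul (x : EuclideanSpace ℝ (Fin (d + 1))) {r : ℝ} (hr : 0 < r) :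
    volume (Metric.ball x (2 * r)) = ENNReal.ofReal r *
      (volume (Metric.ball (0 : EuclideanSpace ℝ (Fin (d + 1))) 2) * ENNReal.ofReal r ^ d) := by
  rw [mul_comm 2 r, Measure.addHaar_ball_mul_of_pos _ _ hr, finrank_euclideanSpace_fin,
    ENNReal.ofReal_pow hr.le, pow_succ]
  ring

theorem lintegral_enorm_fderiv_cutoff_le {η : EuclideanSpace ℝ (Fin (d + 1)) → ℝ} {L r : ℝ}
    {x : EuclideanSpace ℝ (Fin (d + 1))} (hL : 0 ≤ L) (hr : 0 < r)
    (hη : tsupport η ⊆ Metric.ball x (2 * r)) (hηL : ∀ y, ‖fderiv ℝ η y‖ ≤ L / r) :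
    ∫⁻ y, ‖fderiv ℝ η y‖ₑ ≤ ENNReal.ofReal L *
      (volume (Metric.ball (0 : EuclideanSpace ℝ (Fin (d + 1))) 2) * ENNReal.ofReal r ^ d) := by
  calc ∫⁻ y, ‖fderiv ℝ η y‖ₑ = ∫⁻ y in Metric.ball x (2 * r), ‖fderiv ℝ η y‖ₑ :=
        (setLIntegral_enorm_fderiv _ hη).symm
    _ ≤ ∫⁻ _ in Metric.ball x (2 * r), ENNReal.ofReal (L / r) := by
        refine lintegral_mono fun y => ?_
        rw [← ofReal_norm]
        exact ENNReal.ofReal_le_ofReal (hηL y)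
    _ = _ := by
        rw [setLIntegral_const, volume_ball_two_mul x hr, ← mul_assoc,
          ← ENNReal.ofReal_mul (by positivity), div_mul_cancel₀ _ hr.ne']

theorem lintegral_enorm_fderiv_indicator_prod_le {G : Set (EuclideanSpace ℝ (Fin N))}
    (hG : IsOpen G) {ι : Type*} {F : Finset ι} {η : ι → EuclideanSpace ℝ (Fin N) → ℝ}
    (hη : ∀ i, ContDiff ℝ 1 (η i)) (h01 : ∀ i x, η i x ∈ Icc (0 : ℝ) 1)
    (hts : tsupport (G.indicator fun y => ∏ i ∈ F, (1 - η i y)) ⊆ G) :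
    ∫⁻ y, ‖fderiv ℝ (G.indicator fun y => ∏ i ∈ F, (1 - η i y)) y‖ₑ ≤
      ∑ i ∈ F, ∫⁻ y, ‖fderiv ℝ (η i) y‖ₑ := by
  rw [← lintegral_finsetSum _ fun i _ => ((hη i).continuous_fderiv one_ne_zero).enorm.measurable]
  refine lintegral_mono fun y => ?_
  simp_rw [← ofReal_norm]
  rw [← ENNReal.ofReal_sum_of_nonneg fun i _ => norm_nonneg _]
  refine ENNReal.ofReal_le_ofReal ((norm_fderiv_indicator_le hG hts y).trans
    ((norm_fderiv_finset_prod_le (fun i _ => ((hη i).differentiable one_ne_zero y).const_sub 1)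
      fun i _ => ?_).trans_eq ?_))
  · rw [Real.norm_of_nonneg (sub_nonneg.2 (h01 i y).2)]
    exact sub_le_self _ (h01 i y).1
  · simp_rw [fderiv_const_sub, norm_neg]

theorem volume_le_lintegral_indicator_prod_add {G : Set (EuclideanSpace ℝ (Fin N))}
    (hG : IsOpen G) {ι : Type*} {F : Finset ι} {η : ι → EuclideanSpace ℝ (Fin N) → ℝ}
    {U : ι → Set (EuclideanSpace ℝ (Fin N))} (hU : ∀ i, IsOpen (U i))
    (hη : ∀ i, tsupport (η i) ⊆ U i) :
    volume G ≤
      (∫⁻ y, ‖G.indicator (fun y => ∏ i ∈ F, (1 - η i y)) y‖ₑ) + ∑ i ∈ F, volume (U i) := by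
  have hmeas : MeasurableSet (G \ ⋃ i ∈ F, U i) :=
    hG.measurableSet.diff (F.measurableSet_biUnion fun i _ => (hU i).measurableSet)
  have hone : ∀ y ∈ G \ ⋃ i ∈ F, U i, G.indicator (fun y => ∏ i ∈ F, (1 - η i y)) y = 1 := by
    intro y hy
    rw [indicator_of_mem hy.1]
    refine Finset.prod_eq_one fun i hi => ?_
    rw [image_eq_zero_of_notMem_tsupport fun h => hy.2 (mem_biUnion hi (hη i h)), sub_zero]
  calc volume G ≤ volume (G \ ⋃ i ∈ F, U i) + volume (⋃ i ∈ F, U i) :=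
        (measure_mono (by simp)).trans (measure_union_le _ _)
    _ = (∫⁻ y in G \ ⋃ i ∈ F, U i, ‖G.indicator (fun y => ∏ i ∈ F, (1 - η i y)) y‖ₑ) +
          volume (⋃ i ∈ F, U i) := by
        rw [← setLIntegral_one]
        congr 1
        exact setLIntegral_congr_fun hmeas fun y hy => by rw [hone y hy, enorm_one]
    _ ≤ _ := add_le_add (setLIntegral_le_lintegral _ _) (measure_biUnion_finset_le _ _)

theorem exists_testFunction_volume_le (hd : d ≠ 0) : ∃ C : ℝ, 0 < C ∧
    ∀ {G : Set (EuclideanSpace ℝ (Fin (d + 1)))} {a : ℝ≥0∞} {δ : ℝ}, IsOpen G →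
      IsCompact (closure G) → μH[(d : ℝ)] (frontier G) < a → 0 < δ →
      ∃ u ∈ testFunctions G, ∫⁻ x, ‖fderiv ℝ u x‖ₑ ≤ ENNReal.ofReal C * a ∧
        volume G ≤ (∫⁻ x, ‖u x‖ₑ) + ENNReal.ofReal δ * (ENNReal.ofReal C * a) := by
  obtain ⟨L, hL, hcut⟩ := exists_cutoff (EuclideanSpace ℝ (Fin (d + 1))) one_pos one_lt_two
  set c := volume (Metric.ball (0 : EuclideanSpace ℝ (Fin (d + 1))) 2)
  have hc : ENNReal.ofReal c.toReal = c := ENNReal.ofReal_toReal measure_ball_lt_top.ne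
  have hC : (max L 1) * c.toReal ≠ 0 := (mul_pos (by positivity) (ENNReal.toReal_pos
    (Metric.measure_ball_pos _ _ two_pos).ne' measure_ball_lt_top.ne)).ne'
  refine ⟨max L 1 * c.toReal, by positivity, fun {G a δ} hG hGc ha hδ => ?_⟩
  obtain ⟨F, x, r, hr, hcov, hsum⟩ := exists_finset_ball_cover_of_hausdorffMeasure_lt hd
    (hGc.of_isClosed_subset isClosed_frontier frontier_subset_closure) ha hδ
  choose η hη h01 h1 hηs hηL using fun i => hcut (x i) (r i) (hr i).1
  have hu := indicator_prod_mem_testFunctions hG hGc (fun i _ => hη i)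
    (fun _ _ => Metric.isOpen_ball) hcov fun i _ y hy =>
      h1 i y (by rw [one_mul]; exact Metric.ball_subset_closedBall hy)
  rw [ENNReal.ofReal_mul (by positivity), hc, mul_assoc]
  refine ⟨_, hu, ?_, ?_⟩
  · calc _ ≤ ∑ i ∈ F, ∫⁻ y, ‖fderiv ℝ (η i) y‖ₑ := lintegral_enorm_fderiv_indicator_prod_le hG
          (fun i => (hη i).of_le (by simp)) h01 hu.2.2
      _ ≤ ∑ i ∈ F, ENNReal.ofReal L * (c * ENNReal.ofReal (r i) ^ d) :=
          Finset.sum_le_sum fun i _ =>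
            lintegral_enorm_fderiv_cutoff_le hL.le (hr i).1 (hηs i) (hηL i)
      _ ≤ _ := by
          rw [← Finset.mul_sum, ← Finset.mul_sum]
          gcongr
          exact le_max_left _ _
  · refine (volume_le_lintegral_indicator_prod_add hG (F := F)
      (fun i => Metric.isOpen_ball) hηs).trans (add_le_add le_rfl ?_)
    calc ∑ i ∈ F, volume (Metric.ball (x i) (2 * r i))
        ≤ ∑ i ∈ F, ENNReal.ofReal δ * (c * ENNReal.ofReal (r i) ^ d) := by
          refine Finset.sum_le_sum fun i _ => ?_
          rw [volume_ball_two_mul _ (hr i).1]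
          gcongr
          exact (hr i).2
      _ ≤ ENNReal.ofReal δ * (1 * (c * a)) := by
          rw [← Finset.mul_sum, ← Finset.mul_sum, one_mul]
          gcongr
      _ ≤ _ := by
          gcongr
          exact ENNReal.one_le_ofReal.2 (le_max_right _ _)

theorem exists_volume_le_hausdorffMeasure_frontier (hd : d ≠ 0) : ∃ K : ℝ, 0 < K ∧
    ∀ {G : Set (EuclideanSpace ℝ (Fin (d + 1)))} {A : ℝ}, IsOpen G → IsCompact (closure G) →
      0 < A → (∀ u ∈ testFunctions G, ∫⁻ x, ‖u x‖ₑ ≤ ENNReal.ofReal A * ∫⁻ x, ‖fderiv ℝ u x‖ₑ) →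
      volume G ≤ ENNReal.ofReal (K * A) * μH[(d : ℝ)] (frontier G) := by
  obtain ⟨K, hK, hKG⟩ := exists_testFunction_volume_le hd
  refine ⟨K, hK, fun {G A} hG hGc hA hpoin => ?_⟩
  set H := μH[(d : ℝ)] (frontier G)
  rcases eq_or_ne H ⊤ with hH | hH
  · simp [hH, ENNReal.mul_top, hK, hA]
  have hvol (δ : ℝ) (hδ : 0 < δ) :
      volume G ≤ ENNReal.ofReal (K * (A + δ)) * (H + ENNReal.ofReal δ) := by
    obtain ⟨u, hu, hgrad, hGu⟩ :=
      hKG hG hGc (ENNReal.lt_add_right hH (ENNReal.ofReal_pos.2 hδ).ne') hδ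
    calc volume G ≤ (∫⁻ x, ‖u x‖ₑ) +
            ENNReal.ofReal δ * (ENNReal.ofReal K * (H + ENNReal.ofReal δ)) := hGu
      _ ≤ ENNReal.ofReal A * (ENNReal.ofReal K * (H + ENNReal.ofReal δ)) +
            ENNReal.ofReal δ * (ENNReal.ofReal K * (H + ENNReal.ofReal δ)) := by
          gcongr
          exact (hpoin u hu).trans (by gcongr)
      _ = _ := by
          rw [ENNReal.ofReal_mul hK.le, ENNReal.ofReal_add hA.le hδ.le]
          ring
  have hlim : Tendsto (fun δ : ℝ => ENNReal.ofReal (K * (A + δ)) * (H + ENNReal.ofReal δ)) (𝓝[>] 0)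
      (𝓝 (ENNReal.ofReal (K * (A + 0)) * (H + ENNReal.ofReal 0))) := by
    refine Tendsto.mono_left ?_ nhdsWithin_le_nhds
    refine ENNReal.Tendsto.mul ((ENNReal.continuous_ofReal.comp (by fun_prop)).tendsto _)
      (Or.inr (by finiteness)) ((continuous_const.add ENNReal.continuous_ofReal).tendsto _)
      (Or.inr ENNReal.ofReal_ne_top)
  simpa using ge_of_tendsto hlim (mem_of_superset self_mem_nhdsWithin hvol)

theorem exists_div_le_cheegerConstant_of_poincare (hN : 2 ≤ N) : ∃ K : ℝ, 0 < K ∧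
    ∀ {Ω : Set (EuclideanSpace ℝ (Fin N))} {A : ℝ}, 0 < A →
      (∀ u ∈ testFunctions Ω, ∫⁻ x, ‖u x‖ₑ ≤ ENNReal.ofReal A * ∫⁻ x, ‖fderiv ℝ u x‖ₑ) →
      ENNReal.ofReal (K / A) ≤ cheegerConstant Ω := by
  obtain ⟨d, rfl⟩ : ∃ d, N = d + 1 := ⟨N - 1, by omega⟩
  obtain ⟨K, hK, hvol⟩ := exists_volume_le_hausdorffMeasure_frontier (d := d) (by omega)
  let κ := Measure.addHaarScalarFactor (volume : Measure (EuclideanSpace ℝ (Fin d))) μH[d]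
  have hκ : (0 : ℝ) < κ := NNReal.coe_pos.2 <| pos_iff_ne_zero.2 <|
    Measure.addHaarScalarFactor_volume_hausdorffMeasure_ne_zero d
  refine ⟨κ / K, by positivity, fun {Ω A} hA hpoin => le_iInf₂ fun G hG => ?_⟩
  obtain ⟨hGo, hGn, hGc, hGΩ, -⟩ := hG
  have hμHE : (μHE[d + 1 - 1] : Measure (EuclideanSpace ℝ (Fin (d + 1)))) (frontier G)
      = κ * μH[(d : ℝ)] (frontier G) := rfl
  rw [hμHE, ENNReal.le_div_iff_mul_le (Or.inl (hGo.measure_pos volume hGn).ne')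
    (Or.inl ((measure_mono subset_closure).trans_lt hGc.measure_lt_top).ne)]
  calc ENNReal.ofReal (κ / K / A) * volume G
      ≤ ENNReal.ofReal (κ / K / A) * (ENNReal.ofReal (K * A) * μH[(d : ℝ)] (frontier G)) := by
        gcongr
        exact hvol hGo hGc hA fun u hu =>
          hpoin u ⟨hu.1, hu.2.1, hu.2.2.trans (subset_closure.trans hGΩ)⟩
    _ = _ := by
        rw [← mul_assoc, ← ENNReal.ofReal_mul (by positivity),
          show (κ : ℝ) / K / A * (K * A) = κ by field_simp, ENNReal.ofReal_coe_nnreal]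

theorem lt_relCap_of_capInradius_lt {p γ r : ℝ} {Ω : Set (EuclideanSpace ℝ (Fin N))}
    (hΩ : IsOpen Ω) (hr : 0 < r) (h : capInradius p γ Ω < ENNReal.ofReal r)
    (x₀ : EuclideanSpace ℝ (Fin N)) :
    ENNReal.ofReal γ * relCap p (Metric.closedBall x₀ r) (Metric.ball x₀ (2 * r)) <
      relCap p (Metric.closedBall x₀ r \ Ω) (Metric.ball x₀ (2 * r)) := by
  by_contra! hle
  refine h.not_ge (le_iSup₂_of_le (f := fun (r : ℝ) _ => ENNReal.ofReal r) r ?_ le_rfl)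
  exact ⟨hr, x₀, (isCompact_closedBall _ _).diff hΩ, sdiff_subset, hle⟩

theorem exists_div_capInradius_le_cheegerConstant (hN : 2 ≤ N) : ∃ σ : ℝ, 0 < σ ∧
    ∀ γ ∈ Ioo (0 : ℝ) 1, ∀ Ω : Set (EuclideanSpace ℝ (Fin N)), IsOpen Ω →
      ENNReal.ofReal (σ * γ) / capInradius 1 γ Ω ≤ cheegerConstant Ω := by
  have : NeZero N := ⟨by omega⟩
  obtain ⟨P, hP, hpoin⟩ := exists_poincare_const N
  obtain ⟨K, hK, hcheeger⟩ := exists_div_le_cheegerConstant_of_poincare hN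
  refine ⟨K / P, by positivity, fun γ ⟨hγ, _⟩ Ω hΩ => ?_⟩
  rcases eq_or_ne (capInradius 1 γ Ω) ⊤ with htop | htop
  · simp [htop]
  obtain ⟨R, hR0, hR⟩ : ∃ R : ℝ, 0 ≤ R ∧ capInradius 1 γ Ω = ENNReal.ofReal R :=
    ⟨_, ENNReal.toReal_nonneg, (ENNReal.ofReal_toReal htop).symm⟩
  have hlt (r : ℝ) (hRr : R < r) :
      ENNReal.ofReal (K / P * γ) / ENNReal.ofReal r ≤ cheegerConstant Ω := by
    have hr : 0 < r := hR0.trans_lt hRr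
    have hcap (x₀) := (lt_relCap_of_capInradius_lt hΩ hr
      (hR.trans_lt ((ENNReal.ofReal_lt_ofReal_iff hr).2 hRr)) x₀).le
    rw [← ENNReal.ofReal_div_of_pos hr, show K / P * γ / r = K / (P * r / γ) by field_simp]
    exact hcheeger (by positivity) (hpoin hγ hr hcap)
  rw [hR]
  exact le_of_tendsto (x := 𝓝[>] R) (ENNReal.Tendsto.const_div
    ((ENNReal.continuous_ofReal.tendsto R).mono_left nhdsWithin_le_nhds)
    (Or.inr ENNReal.ofReal_ne_top)) (mem_of_superset self_mem_nhdsWithin hlt)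

end LowerBound

section Coarea

theorem exists_finset_separated_cover {X : Type*} [PseudoMetricSpace X] {K : Set X}
    (hK : IsCompact K) {δ : ℝ} (hδ : 0 < δ) :
    ∃ S : Finset X, (↑S : Set X) ⊆ K ∧ K ⊆ ⋃ x ∈ S, Metric.closedBall x δ ∧
      (↑S : Set X).PairwiseDisjoint fun x => Metric.ball x (δ / 2) := by
  lift δ to NNReal using hδ.le
  have hpack : Metric.packingNumber δ K ≠ ⊤ := by
    obtain ⟨T, -, hTfin, hT⟩ := Metric.exists_finite_isCover_of_isCompact
      (ε := δ / 2) (half_pos (NNReal.coe_pos.1 hδ)).ne' hK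
    have hle := Metric.packingNumber_two_mul_le_externalCoveringNumber (δ / 2) K
    rw [mul_div_cancel₀ _ two_ne_zero] at hle
    exact ((hle.trans hT.externalCoveringNumber_le_encard).trans_lt hTfin.encard_lt_top).ne
  have hfin : (Metric.maximalSeparatedSet δ K).Finite := by
    rwa [← encard_ne_top_iff, Metric.encard_maximalSeparatedSet hpack]
  refine ⟨hfin.toFinset, by simpa using Metric.maximalSeparatedSet_subset, ?_,
    fun x hx y hy hxy => Metric.ball_disjoint_ball ?_⟩
  · simpa using Metric.isCover_iff_subset_iUnion_closedBall.1
      (Metric.isCover_maximalSeparatedSet hpack)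
  · have hsep : (δ : ℝ≥0∞) < edist x y := Metric.isSeparated_maximalSeparatedSet
      (ε := δ) (A := K) (by simpa using hx) (by simpa using hy) hxy
    rw [add_halves, dist_edist]
    exact ENNReal.toReal_mono (edist_ne_top _ _) hsep.le

theorem mapsTo_closedBall_of_norm_fderiv_sub_le {E F : Type*} [NormedAddCommGroup E]
    [NormedSpace ℝ E] [NormedAddCommGroup F] [NormedSpace ℝ F] {v : E → F} {x : E} {δ ε : ℝ}
    (hv : ∀ y ∈ Metric.closedBall x δ, DifferentiableAt ℝ v y)
    (hosc : ∀ y ∈ Metric.closedBall x δ, ‖fderiv ℝ v y - fderiv ℝ v x‖ ≤ ε) :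
    MapsTo v (Metric.closedBall x δ) (Metric.closedBall (v x) ((‖fderiv ℝ v x‖ + ε) * δ)) := by
  intro y hy
  have hδ : 0 ≤ δ := Metric.nonneg_of_mem_closedBall hy
  have hε : 0 ≤ ε := (norm_nonneg _).trans (hosc y hy)
  have hlip : ‖v y - v x‖ ≤ (‖fderiv ℝ v x‖ + ε) * ‖y - x‖ :=
    (convex_closedBall x δ).norm_image_sub_le_of_norm_fderiv_le hv
      (fun z hz => norm_le_insert' _ _ |>.trans (by gcongr; exact hosc z hz))
      (Metric.mem_closedBall_self hδ) hy
  rw [mem_closedBall_iff_norm] at hy ⊢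
  exact hlip.trans (by gcongr)

variable {d : ℕ}

theorem pow_mul_volume_closedBall_le {v : EuclideanSpace ℝ (Fin (d + 1)) → ℝ}
    {x : EuclideanSpace ℝ (Fin (d + 1))} {δ ε : ℝ} (hδ : 0 < δ)
    (hosc : ∀ y ∈ Metric.closedBall x δ, ‖fderiv ℝ v y - fderiv ℝ v x‖ ≤ ε) :
    ENNReal.ofReal (2 * δ) ^ d *
        volume (Metric.closedBall (v x) ((‖fderiv ℝ v x‖ + ε) * δ)) ≤
      ENNReal.ofReal (4 ^ (d + 1)) /
        volume (Metric.ball (0 : EuclideanSpace ℝ (Fin (d + 1))) 1) *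
        ∫⁻ y in Metric.ball x (δ / 2), (‖fderiv ℝ v y‖ₑ + ENNReal.ofReal (2 * ε)) := by
  set ω := volume (Metric.ball (0 : EuclideanSpace ℝ (Fin (d + 1))) 1)
  have hε : 0 ≤ ε := (norm_nonneg _).trans (hosc x (Metric.mem_closedBall_self hδ.le))
  have hvol : ENNReal.ofReal (4 ^ (d + 1)) / ω * volume (Metric.ball x (δ / 2)) =
      ENNReal.ofReal ((2 * δ) ^ (d + 1)) := by
    rw [Measure.addHaar_ball _ _ (by positivity), finrank_euclideanSpace_fin, mul_left_comm,
      ENNReal.div_mul_cancel (Metric.measure_ball_pos _ _ one_pos).ne' measure_ball_lt_top.ne,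
      ← ENNReal.ofReal_mul (by positivity), ← mul_pow]
    ring_nf
  calc ENNReal.ofReal (2 * δ) ^ d * volume (Metric.closedBall (v x) ((‖fderiv ℝ v x‖ + ε) * δ))
      = ENNReal.ofReal ((2 * δ) ^ (d + 1)) * ENNReal.ofReal (‖fderiv ℝ v x‖ + ε) := by
        rw [Real.volume_closedBall, ← ENNReal.ofReal_pow (by positivity),
          ← ENNReal.ofReal_mul (by positivity), ← ENNReal.ofReal_mul (by positivity)]
        ring_nf
    _ = ENNReal.ofReal (4 ^ (d + 1)) / ω *
        ∫⁻ _ in Metric.ball x (δ / 2), ENNReal.ofReal (‖fderiv ℝ v x‖ + ε) := by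
        rw [setLIntegral_const, ← hvol]
        ring
    _ ≤ _ := by
        gcongr ENNReal.ofReal (4 ^ (d + 1)) / ω * ?_
        refine setLIntegral_mono' measurableSet_ball fun y hy => ?_
        rw [← ofReal_norm, ← ENNReal.ofReal_add (norm_nonneg _) (by positivity)]
        refine ENNReal.ofReal_le_ofReal ?_
        have hyx := hosc y (Metric.ball_subset_closedBall
          (Metric.ball_subset_ball (half_le_self hδ.le) hy))
        linarith [norm_sub_norm_le (fderiv ℝ v x) (fderiv ℝ v y),
          norm_sub_rev (fderiv ℝ v x) (fderiv ℝ v y)]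

theorem ediam_closedBall_le {X : Type*} [PseudoMetricSpace X] (x : X) (δ : ℝ) :
    Metric.ediam (Metric.closedBall x δ) ≤ ENNReal.ofReal (2 * δ) := by
  refine Metric.ediam_le fun y hy z hz => ?_
  rw [edist_dist]
  refine ENNReal.ofReal_le_ofReal ?_
  linarith [dist_triangle_right y z x, Metric.mem_closedBall.1 hy, Metric.mem_closedBall.1 hz]

-- Cover by balls of radius `δ`, on each of which `fderiv ℝ v` oscillates by at most `ε`: then only
-- the levels within `(‖fderiv ℝ v x‖ + ε) * δ` of `v x` meet the ball around `x`.
theorem exists_discrete_coarea (hd : d ≠ 0) {v : EuclideanSpace ℝ (Fin (d + 1)) → ℝ}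
    (hv : Differentiable ℝ v) (huc : UniformContinuous (fderiv ℝ v))
    (x₀ : EuclideanSpace ℝ (Fin (d + 1))) {r : ℝ} (hr : 0 < r) {ε : ℝ} (hε : 0 < ε) :
    ∃ (S : Finset (EuclideanSpace ℝ (Fin (d + 1)))) (δ : ℝ) (g : ℝ → ℝ≥0∞), 0 < δ ∧ δ ≤ ε ∧
      Measurable g ∧ Metric.closedBall x₀ r ⊆ ⋃ x ∈ S, Metric.closedBall x δ ∧
      (∀ t, ∑ x ∈ S, Metric.ediam (Metric.closedBall x δ ∩ v ⁻¹' {t}) ^ (d : ℝ) ≤ g t) ∧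
      ∫⁻ t, g t ≤ ENNReal.ofReal (4 ^ (d + 1)) /
        volume (Metric.ball (0 : EuclideanSpace ℝ (Fin (d + 1))) 1) *
        ∫⁻ x in Metric.ball x₀ (2 * r), (‖fderiv ℝ v x‖ₑ + ENNReal.ofReal (2 * ε)) := by
  obtain ⟨δ₀, hδ₀, huc⟩ := Metric.uniformContinuous_iff.1 huc ε hε
  obtain ⟨δ, hδ, hδlt⟩ := exists_between (lt_min hδ₀ (lt_min hr hε))
  obtain ⟨hδδ₀, hδr, hδε⟩ : δ < δ₀ ∧ δ < r ∧ δ < ε := by simpa using hδlt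
  have hosc (x) : ∀ y ∈ Metric.closedBall x δ, ‖fderiv ℝ v y - fderiv ℝ v x‖ ≤ ε := fun y hy => by
    rw [← dist_eq_norm]
    exact (huc (hδδ₀.trans_le' hy)).le
  obtain ⟨S, hSK, hcov, hdisj⟩ := exists_finset_separated_cover (isCompact_closedBall x₀ r) hδ
  let B (x : EuclideanSpace ℝ (Fin (d + 1))) : Set ℝ :=
    Metric.closedBall (v x) ((‖fderiv ℝ v x‖ + ε) * δ)
  have hBmeas (x) : Measurable ((B x).indicator fun _ => ENNReal.ofReal (2 * δ) ^ d) :=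
    measurable_const.indicator measurableSet_closedBall
  refine ⟨S, δ, fun t => ∑ x ∈ S, (B x).indicator (fun _ => ENNReal.ofReal (2 * δ) ^ d) t, hδ,
    hδε.le, Finset.measurable_sum _ fun x _ => hBmeas x, hcov,
    fun t => Finset.sum_le_sum fun x _ => ?_, ?_⟩
  · rw [ENNReal.rpow_natCast]
    rcases (Metric.closedBall x δ ∩ v ⁻¹' {t}).eq_empty_or_nonempty with h | ⟨y, hy, rfl⟩
    · simp [h, hd]
    · rw [indicator_of_mem (mapsTo_closedBall_of_norm_fderiv_sub_le (fun z _ => hv z) (hosc x) hy)]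
      gcongr
      exact (Metric.ediam_mono inter_subset_left).trans (ediam_closedBall_le x δ)
  · rw [lintegral_finsetSum _ fun x _ => hBmeas x]
    refine (Finset.sum_le_sum fun x _ => (lintegral_indicator_const measurableSet_closedBall
      _).trans_le (pow_mul_volume_closedBall_le hδ (hosc x))).trans ?_
    rw [← Finset.mul_sum, ← lintegral_biUnion_finset hdisj fun x _ => measurableSet_ball]
    gcongr
    refine iUnion₂_subset fun x hx => Metric.ball_subset_ball' ?_
    linarith [Metric.mem_closedBall.1 (hSK hx)]

theorem hausdorffMeasure_inter_le_liminf_sum_ediam {X : Type*} [MetricSpace X] [MeasurableSpace X]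
    [BorelSpace X] {K : Set X} {S : ℕ → Finset X} {δ : ℕ → ℝ} (hδ : Tendsto δ atTop (𝓝 0))
    (hcov : ∀ n, K ⊆ ⋃ x ∈ S n, Metric.closedBall x (δ n)) (A : Set X) (p : ℝ) :
    μH[p] (K ∩ A) ≤
      liminf (fun n => ∑ x ∈ S n, Metric.ediam (Metric.closedBall x (δ n) ∩ A) ^ p) atTop := by
  have hscale : Tendsto (fun n => ENNReal.ofReal (2 * δ n)) atTop (𝓝 0) := by
    simpa using ENNReal.tendsto_ofReal (hδ.const_mul 2)
  have hle := Measure.hausdorffMeasure_le_liminf_sum (ι := fun n => S n) p (K ∩ A) _ hscale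
    (fun n x => Metric.closedBall x.1 (δ n) ∩ A)
    (Eventually.of_forall fun n x =>
      (Metric.ediam_mono inter_subset_left).trans (ediam_closedBall_le _ _))
    (Eventually.of_forall fun n y hy => by
      obtain ⟨x, hx, hyx⟩ := mem_iUnion₂.1 (hcov n hy.1)
      exact mem_iUnion.2 ⟨⟨x, hx⟩, hyx, hy.2⟩)
  exact hle.trans_eq (congrArg (liminf · atTop) (funext fun n => Finset.sum_coe_sort (S n)
    fun x => Metric.ediam (Metric.closedBall x (δ n) ∩ A) ^ p))

theorem lintegral_hausdorffMeasure_level_le (hd : d ≠ 0)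
    {v : EuclideanSpace ℝ (Fin (d + 1)) → ℝ} (hv : Differentiable ℝ v)
    (huc : UniformContinuous (fderiv ℝ v)) (x₀ : EuclideanSpace ℝ (Fin (d + 1))) {r : ℝ}
    (hr : 0 < r) :
    ∫⁻ t, μH[(d : ℝ)] (Metric.closedBall x₀ r ∩ v ⁻¹' {t}) ≤ ENNReal.ofReal (4 ^ (d + 1)) /
        volume (Metric.ball (0 : EuclideanSpace ℝ (Fin (d + 1))) 1) *
        ∫⁻ x in Metric.ball x₀ (2 * r), ‖fderiv ℝ v x‖ₑ := by
  set ω := volume (Metric.ball (0 : EuclideanSpace ℝ (Fin (d + 1))) 1)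
  have hω : ω ≠ 0 := (Metric.measure_ball_pos _ _ one_pos).ne'
  choose S δ g hδ hδε hg hcov hsum hint using fun n : ℕ =>
    exists_discrete_coarea hd hv huc x₀ hr (Nat.one_div_pos_of_nat (α := ℝ) (n := n))
  have hδ0 : Tendsto δ atTop (𝓝 0) := squeeze_zero (fun n => (hδ n).le) hδε
    tendsto_one_div_add_atTop_nhds_zero_nat
  have hlim : Tendsto (fun n : ℕ => ENNReal.ofReal (4 ^ (d + 1)) / ω *
      ∫⁻ x in Metric.ball x₀ (2 * r),
        (‖fderiv ℝ v x‖ₑ + ENNReal.ofReal (2 * (1 / ((n : ℝ) + 1))))) atTop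
      (𝓝 (ENNReal.ofReal (4 ^ (d + 1)) / ω * ∫⁻ x in Metric.ball x₀ (2 * r), ‖fderiv ℝ v x‖ₑ)) := by
    have hscale : Tendsto (fun n : ℕ => ENNReal.ofReal (2 * (1 / ((n : ℝ) + 1)))) atTop (𝓝 0) := by
      simpa using ENNReal.tendsto_ofReal
        ((tendsto_one_div_add_atTop_nhds_zero_nat (𝕜 := ℝ)).const_mul 2)
    refine ENNReal.Tendsto.const_mul ?_ (Or.inr (by finiteness))
    simp_rw [lintegral_add_left huc.continuous.enorm.measurable, setLIntegral_const]
    simpa using tendsto_const_nhds.add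
      (ENNReal.Tendsto.mul_const hscale (Or.inr measure_ball_lt_top.ne))
  calc ∫⁻ t, μH[(d : ℝ)] (Metric.closedBall x₀ r ∩ v ⁻¹' {t})
      ≤ ∫⁻ t, liminf (fun n => g n t) atTop := lintegral_mono fun t =>
        (hausdorffMeasure_inter_le_liminf_sum_ediam hδ0 hcov _ _).trans
          (liminf_le_liminf (Eventually.of_forall fun n => hsum n t))
    _ ≤ liminf (fun n => ∫⁻ t, g n t) atTop := lintegral_liminf_le hg
    _ ≤ _ := hlim.liminf_eq ▸ liminf_le_liminf (Eventually.of_forall hint)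

end Coarea

section Sard

theorem finite_inter_preimage_singleton_of_det_fderiv_ne_zero {E : Type*} [NormedAddCommGroup E]
    [NormedSpace ℝ E] [FiniteDimensional ℝ E] {g : E → E} (hg : Differentiable ℝ g) {K : Set E}
    (hK : IsCompact K) {b : E} (hb : ∀ x ∈ g ⁻¹' {b}, (fderiv ℝ g x).det ≠ 0) :
    (K ∩ g ⁻¹' {b}).Finite := by
  refine (hK.inter_right (isClosed_singleton.preimage hg.continuous)).finite
    (isDiscrete_iff_nhdsNE.2 fun x hx => ?_)
  have hne := (hg x).hasFDerivAt.eventually_ne (c := b)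
    ⟨_, ((fderiv ℝ g x).toContinuousLinearEquivOfDetNeZero (hb x hx.2)).antilipschitz⟩
  rw [← disjoint_iff, disjoint_principal_right]
  filter_upwards [hne] with y hy hyK using hy hyK.2

theorem exists_norm_lt_forall_det_fderiv_ne_zero {E : Type*} [NormedAddCommGroup E]
    [NormedSpace ℝ E] [FiniteDimensional ℝ E] [MeasurableSpace E] [BorelSpace E] {g : E → E}
    (hg : Differentiable ℝ g) {ε : ℝ} (hε : 0 < ε) :
    ∃ b, ‖b‖ < ε ∧ ∀ x ∈ g ⁻¹' {b}, (fderiv ℝ g x).det ≠ 0 := by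
  let μ : Measure E := Measure.addHaar
  have hnull : μ (g '' {x | (fderiv ℝ g x).det = 0}) = 0 :=
    addHaar_image_eq_zero_of_det_fderivWithin_eq_zero μ
      (fun x _ => (hg x).hasFDerivAt.hasFDerivWithinAt) fun x hx => hx
  by_contra! hcon
  refine (Metric.measure_ball_pos μ 0 hε).ne' (measure_mono_null (fun b hb => ?_) hnull)
  obtain ⟨x, hx, hdet⟩ := hcon b (mem_ball_zero_iff.1 hb)
  exact ⟨x, hdet, hx⟩

theorem exists_norm_lt_finite_fderiv_add_innerSL_eq_zero {E : Type*} [NormedAddCommGroup E]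
    [InnerProductSpace ℝ E] [FiniteDimensional ℝ E] {u : E → ℝ} (hu : ContDiff ℝ 2 u) {K : Set E}
    (hK : IsCompact K) {ε : ℝ} (hε : 0 < ε) :
    ∃ a : E, ‖a‖ < ε ∧ {x ∈ K | fderiv ℝ u x + innerSL ℝ a = 0}.Finite := by
  borelize E
  have hg : Differentiable ℝ (gradient u) :=
    ((InnerProductSpace.toDual ℝ E).symm.toContinuousLinearEquiv.contDiff.comp
      (hu.fderiv_right (m := 1) (by norm_num))).differentiable one_ne_zero
  obtain ⟨b, hb, hdet⟩ := exists_norm_lt_forall_det_fderiv_ne_zero hg hε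
  refine ⟨-b, by rwa [norm_neg], ?_⟩
  convert finite_inter_preimage_singleton_of_det_fderiv_ne_zero hg hK hdet using 1
  ext x
  rw [mem_inter_iff, mem_preimage, mem_singleton_iff, mem_ofPred_eq, map_neg, ← sub_eq_add_neg,
    sub_eq_zero, gradient, LinearIsometryEquiv.symm_apply_eq]
  rfl

end Sard

section UpperBound

theorem frontier_inter_preimage_Ioi_subset {X : Type*} [TopologicalSpace X] {U : Set X}
    (hU : IsOpen U) {v : X → ℝ} (hv : Continuous v) {t : ℝ}
    (hcl : closure (U ∩ v ⁻¹' Ioi t) ⊆ U) :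
    frontier (U ∩ v ⁻¹' Ioi t) ⊆ U ∩ v ⁻¹' {t} := by
  intro x hx
  rw [(hU.inter (isOpen_Ioi.preimage hv)).frontier_eq] at hx
  have hle : t ≤ v x := closure_minimal (fun y hy => (mem_Ioi.1 hy.2).le)
    (isClosed_Ici.preimage hv) hx.1
  exact ⟨hcl hx.1, le_antisymm (not_lt.1 fun hlt => hx.2 ⟨hcl hx.1, hlt⟩) hle⟩

theorem hasSmoothBoundary_inter_preimage_Ioi {N : ℕ} {U : Set (EuclideanSpace ℝ (Fin N))}
    (hU : IsOpen U) {v : EuclideanSpace ℝ (Fin N) → ℝ} (hv : ContDiff ℝ (⊤ : ℕ∞) v) {t : ℝ}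
    (hcl : closure (U ∩ v ⁻¹' Ioi t) ⊆ U) (hreg : ∀ x ∈ U, v x = t → fderiv ℝ v x ≠ 0) :
    HasSmoothBoundary (U ∩ v ⁻¹' Ioi t) := by
  intro x hx
  obtain ⟨hxU, hvx⟩ := frontier_inter_preimage_Ioi_subset hU hv.continuous hcl hx
  refine ⟨U, hU, hxU, fun y => t - v y, (contDiff_const.sub hv).contDiffOn,
    sub_eq_zero.2 (mem_singleton_iff.1 hvx).symm, fun hgrad => hreg x hxU hvx ?_, ?_⟩
  · rwa [gradient, LinearIsometryEquiv.map_eq_zero_iff, fderiv_const_sub, neg_eq_zero] at hgrad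
  · ext y
    simp only [mem_inter_iff, mem_preimage, mem_Ioi, mem_ofPred_eq, sub_neg]
    tauto

theorem lintegral_ofReal_sub_eq_lintegral_meas_lt {α : Type*} [MeasurableSpace α] (μ : Measure α)
    {u : α → ℝ} (hu : AEMeasurable u μ) (c : ℝ) :
    ∫⁻ x, ENNReal.ofReal (u x - c) ∂μ = ∫⁻ t in Ioi 0, μ {x | t + c < u x} := by
  have hcake := lintegral_eq_lintegral_meas_lt μ (f := fun x => max (u x - c) 0)
    (Eventually.of_forall fun _ => le_max_right _ _) ((hu.sub_const c).max aemeasurable_const)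
  simp only [ENNReal.ofReal_max, ENNReal.ofReal_zero, max_zero] at hcake
  rw [hcake]
  refine setLIntegral_congr_fun measurableSet_Ioi fun t ht => ?_
  simp only [lt_max_iff, (mem_Ioi.1 ht).not_gt, or_false, lt_sub_iff_add_lt]

theorem cheegerSets_mono {N : ℕ} {Ω Ω' : Set (EuclideanSpace ℝ (Fin N))} (h : Ω ⊆ Ω') :
    cheegerSets Ω ⊆ cheegerSets Ω' := fun _ hG =>
  ⟨hG.1, hG.2.1, hG.2.2.1, hG.2.2.2.1.trans h, hG.2.2.2.2⟩

theorem cheegerConstant_anti {N : ℕ} {Ω Ω' : Set (EuclideanSpace ℝ (Fin N))} (h : Ω ⊆ Ω') :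
    cheegerConstant Ω' ≤ cheegerConstant Ω :=
  biInf_mono (cheegerSets_mono h)

theorem cheegerConstant_mul_volume_le {N : ℕ} {Ω G : Set (EuclideanSpace ℝ (Fin N))}
    (hG : G ∈ cheegerSets Ω) :
    cheegerConstant Ω * volume G ≤
      (μHE[N - 1] : Measure (EuclideanSpace ℝ (Fin N))) (frontier G) := by
  rw [← ENNReal.le_div_iff_mul_le (Or.inl (hG.1.measure_pos volume hG.2.1).ne')
    (Or.inl (hG.2.2.1.measure_lt_top.trans_le' (measure_mono subset_closure)).ne)]
  exact iInf₂_le G hG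

variable {d : ℕ} {u v : EuclideanSpace ℝ (Fin (d + 1)) → ℝ} {x₀ : EuclideanSpace ℝ (Fin (d + 1))}
  {r δ : ℝ}

theorem cheegerConstant_mul_volume_superlevel_le (hu : tsupport u ⊆ Metric.ball x₀ r)
    (hv : ContDiff ℝ (⊤ : ℕ∞) v) (hδ : 0 ≤ δ) (huv : ∀ x ∈ Metric.closedBall x₀ r, |v x - u x| ≤ δ)
    {t : ℝ} (ht : δ < t) (hreg : ∀ x ∈ Metric.closedBall x₀ r, v x = t → fderiv ℝ v x ≠ 0) :
    cheegerConstant {x | 0 < u x} * volume {x | t + δ < u x} ≤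
      (μHE[d] : Measure (EuclideanSpace ℝ (Fin (d + 1)))) (Metric.closedBall x₀ r ∩ v ⁻¹' {t}) := by
  have hball {x} (hx : 0 < u x) : x ∈ Metric.ball x₀ r := hu (subset_tsupport _ hx.ne')
  set G := Metric.ball x₀ r ∩ v ⁻¹' Ioi t
  have hclosure : closure G ⊆ Metric.closedBall x₀ r ∩ v ⁻¹' Ici t :=
    closure_minimal (inter_subset_inter Metric.ball_subset_closedBall
      (preimage_mono Ioi_subset_Ici_self))
      (Metric.isClosed_closedBall.inter (isClosed_Ici.preimage hv.continuous))
  have hpos : closure G ⊆ {x | 0 < u x} := fun x hx => by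
    obtain ⟨hxr, hxt : t ≤ v x⟩ := hclosure hx
    exact show 0 < u x by linarith [(abs_le.1 (huv x hxr)).2]
  have hcl : closure G ⊆ Metric.ball x₀ r := fun x hx => hball (hpos hx)
  have hsub : {x | t + δ < u x} ⊆ G := fun x (hx : t + δ < u x) => by
    have hxr : x ∈ Metric.ball x₀ r := hball (by linarith)
    have habs := (abs_le.1 (huv x (Metric.ball_subset_closedBall hxr))).1
    exact ⟨hxr, show t < v x by linarith⟩
  rcases G.eq_empty_or_nonempty with hG | hG
  · simp [subset_empty_iff.1 (hG ▸ hsub)]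
  have hmem : G ∈ cheegerSets {x | 0 < u x} :=
    ⟨Metric.isOpen_ball.inter (isOpen_Ioi.preimage hv.continuous), hG,
      (isCompact_closedBall x₀ r).of_isClosed_subset isClosed_closure
        (hclosure.trans inter_subset_left), hpos,
      hasSmoothBoundary_inter_preimage_Ioi Metric.isOpen_ball hv hcl
        fun x hx => hreg x (Metric.ball_subset_closedBall hx)⟩
  calc cheegerConstant {x | 0 < u x} * volume {x | t + δ < u x}
      ≤ cheegerConstant {x | 0 < u x} * volume G := by gcongr
    _ ≤ μHE[d] (frontier G) := cheegerConstant_mul_volume_le hmem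
    _ ≤ _ := measure_mono ((frontier_inter_preimage_Ioi_subset Metric.isOpen_ball hv.continuous
        hcl).trans (inter_subset_inter_left _ Metric.ball_subset_closedBall))

theorem cheegerConstant_mul_lintegral_sub_le (hu : u ∈ testFunctions (Metric.ball x₀ r))
    (hv : ContDiff ℝ (⊤ : ℕ∞) v) (hδ : 0 ≤ δ) (huv : ∀ x ∈ Metric.closedBall x₀ r, |v x - u x| ≤ δ)
    (hfin : {x ∈ Metric.closedBall x₀ r | fderiv ℝ v x = 0}.Finite) :
    cheegerConstant {x | 0 < u x} * ∫⁻ x, ENNReal.ofReal (u x - 2 * δ) ≤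
      ∫⁻ t, (μHE[d] : Measure (EuclideanSpace ℝ (Fin (d + 1))))
        (Metric.closedBall x₀ r ∩ v ⁻¹' {t}) := by
  have hnull : ∀ᵐ t, t + δ ∉ v '' {x ∈ Metric.closedBall x₀ r | fderiv ℝ v x = 0} := by
    filter_upwards [(measurePreserving_add_right volume δ).quasiMeasurePreserving.ae
      ((hfin.image v).countable.ae_notMem volume)] with t ht using ht
  rw [lintegral_ofReal_sub_eq_lintegral_meas_lt volume hu.1.continuous.aemeasurable]
  calc cheegerConstant {x | 0 < u x} * ∫⁻ t in Ioi 0, volume {x | t + 2 * δ < u x}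
      ≤ ∫⁻ t in Ioi 0, cheegerConstant {x | 0 < u x} * volume {x | t + 2 * δ < u x} :=
        lintegral_const_mul_le _ _
    _ ≤ ∫⁻ t in Ioi 0, (μHE[d] : Measure (EuclideanSpace ℝ (Fin (d + 1))))
          (Metric.closedBall x₀ r ∩ v ⁻¹' {t + δ}) := by
        refine lintegral_mono_ae ?_
        filter_upwards [ae_restrict_of_ae hnull, ae_restrict_mem measurableSet_Ioi] with t ht ht0
        rw [two_mul, ← add_assoc]
        exact cheegerConstant_mul_volume_superlevel_le hu.2.2 hv hδ huv
          (lt_add_of_pos_left δ ht0) fun x hx hxt h0 => ht ⟨x, ⟨hx, h0⟩, hxt⟩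
    _ ≤ ∫⁻ t, (μHE[d] : Measure (EuclideanSpace ℝ (Fin (d + 1))))
          (Metric.closedBall x₀ r ∩ v ⁻¹' {t + δ}) := setLIntegral_le_lintegral _ _
    _ = _ := lintegral_add_right_eq_self (fun t => (μHE[d] : Measure
          (EuclideanSpace ℝ (Fin (d + 1)))) (Metric.closedBall x₀ r ∩ v ⁻¹' {t})) δ

theorem exists_perturbation (hu : u ∈ testFunctions (Metric.ball x₀ r)) (hr : 0 < r) (hδ : 0 < δ)
    {q : ℝ} (hq : 0 < q) :
    ∃ v : EuclideanSpace ℝ (Fin (d + 1)) → ℝ, ContDiff ℝ (⊤ : ℕ∞) v ∧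
      UniformContinuous (fderiv ℝ v) ∧ (∀ x ∈ Metric.closedBall x₀ r, |v x - u x| ≤ δ) ∧
      (∀ x, ‖fderiv ℝ v x‖ₑ ≤ ‖fderiv ℝ u x‖ₑ + ENNReal.ofReal q) ∧
      {x ∈ Metric.closedBall x₀ r | fderiv ℝ v x = 0}.Finite := by
  obtain ⟨b, hb, hfin⟩ := exists_norm_lt_finite_fderiv_add_innerSL_eq_zero
    (contDiff_infty.1 hu.1 2) (isCompact_closedBall x₀ r) (lt_min hq (div_pos hδ hr))
  obtain ⟨hbq, hbδ⟩ := lt_min_iff.1 hb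
  have hfderiv : fderiv ℝ (fun x => u x + innerSL ℝ b (x - x₀)) =
      fun x => fderiv ℝ u x + innerSL ℝ b := funext fun x =>
    ((hu.1.differentiable (by simp) x).hasFDerivAt.add
      ((innerSL ℝ b).hasFDerivAt.comp x ((hasFDerivAt_id x).sub_const x₀))).fderiv
  refine ⟨fun x => u x + innerSL ℝ b (x - x₀),
    hu.1.add ((innerSL ℝ b).contDiff.comp (contDiff_id.sub contDiff_const)), ?_,
    fun x hx => ?_, fun x => ?_, by simpa only [hfderiv] using hfin⟩
  · rw [hfderiv]
    exact ((hu.2.1.fderiv ℝ).uniformContinuous_of_continuous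
      (hu.1.continuous_fderiv (by simp))).add uniformContinuous_const
  · rw [add_sub_cancel_left, innerSL_apply_apply]
    calc |inner ℝ b (x - x₀)| ≤ ‖b‖ * ‖x - x₀‖ := abs_real_inner_le_norm _ _
      _ ≤ δ / r * r := by
        gcongr
        exact mem_closedBall_iff_norm.1 hx
      _ = δ := div_mul_cancel₀ _ hr.ne'
  · rw [hfderiv]
    refine (enorm_add_le (E := EuclideanSpace ℝ (Fin (d + 1)) →L[ℝ] ℝ) _ _).trans ?_
    rw [← ofReal_norm (innerSL ℝ b), innerSL_apply_norm]
    gcongr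

theorem exists_lintegral_euclideanHausdorffMeasure_level_le (hd : d ≠ 0) :
    ∃ K : ℝ≥0∞, K ≠ ⊤ ∧ ∀ (v : EuclideanSpace ℝ (Fin (d + 1)) → ℝ) (x₀) {r : ℝ}, 0 < r →
      Differentiable ℝ v → UniformContinuous (fderiv ℝ v) →
      ∫⁻ t, (μHE[d] : Measure (EuclideanSpace ℝ (Fin (d + 1))))
          (Metric.closedBall x₀ r ∩ v ⁻¹' {t}) ≤
        K * ∫⁻ x in Metric.ball x₀ (2 * r), ‖fderiv ℝ v x‖ₑ := by
  let κ : ℝ≥0∞ := Measure.addHaarScalarFactor (volume : Measure (EuclideanSpace ℝ (Fin d))) μH[d]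
  refine ⟨κ * (ENNReal.ofReal (4 ^ (d + 1)) /
    volume (Metric.ball (0 : EuclideanSpace ℝ (Fin (d + 1))) 1)),
    ENNReal.mul_ne_top ENNReal.coe_ne_top (ENNReal.div_ne_top ENNReal.ofReal_ne_top
      (Metric.measure_ball_pos _ _ one_pos).ne'), fun v x₀ r hr hv huc => ?_⟩
  calc ∫⁻ t, (μHE[d] : Measure (EuclideanSpace ℝ (Fin (d + 1))))
        (Metric.closedBall x₀ r ∩ v ⁻¹' {t})
      = κ * ∫⁻ t, μH[(d : ℝ)] (Metric.closedBall x₀ r ∩ v ⁻¹' {t}) :=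
        lintegral_const_mul' κ _ ENNReal.coe_ne_top
    _ ≤ _ := by
        rw [mul_assoc]
        gcongr
        exact lintegral_hausdorffMeasure_level_le hd hv huc x₀ hr

theorem exists_cheegerConstant_mul_lintegral_sub_le (hd : d ≠ 0) : ∃ K : ℝ≥0∞, K ≠ ⊤ ∧
    ∀ {x₀ : EuclideanSpace ℝ (Fin (d + 1))} {r δ : ℝ} {u}, u ∈ testFunctions (Metric.ball x₀ r) →
      0 < r → 0 < δ → cheegerConstant {x | 0 < u x} * ∫⁻ x, ENNReal.ofReal (u x - 2 * δ) ≤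
        K * ∫⁻ x, ‖fderiv ℝ u x‖ₑ := by
  obtain ⟨K, hK, hcoarea⟩ := exists_lintegral_euclideanHausdorffMeasure_level_le hd
  refine ⟨2 * K, by finiteness, fun {x₀ r δ u} hu hr hδ => ?_⟩
  have hu1 := contDiff_one_of_mem_testFunctions hu
  set D := ∫⁻ x, ‖fderiv ℝ u x‖ₑ
  have hDtop : D ≠ ⊤ := (lintegral_enorm_fderiv_lt_top hu).ne
  rcases eq_or_ne D 0 with hD | hD
  · have hu0 : ∫⁻ x, ENNReal.ofReal (u x - 2 * δ) ≤ 0 :=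
      calc ∫⁻ x, ENNReal.ofReal (u x - 2 * δ) ≤ ∫⁻ x, ‖u x‖ₑ := lintegral_mono fun x => by
            rw [← ofReal_norm]
            exact ENNReal.ofReal_le_ofReal (by linarith [Real.le_norm_self (u x)])
        _ ≤ ENNReal.ofReal (2 * r) * D :=
          lintegral_enorm_le_of_tsupport_subset_ball volume hu1 hr hu.2.2
        _ = 0 := by rw [hD, mul_zero]
    rw [nonpos_iff_eq_zero.1 hu0, mul_zero]
    exact zero_le
  let W := volume (Metric.ball x₀ (2 * r))
  have hW0 : W ≠ 0 := (Metric.measure_ball_pos _ _ (by positivity)).ne'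
  have hW : W ≠ ⊤ := measure_ball_lt_top.ne
  have hDW : D / W ≠ ⊤ := ENNReal.div_ne_top hDtop hW0
  obtain ⟨v, hv, huc, huv, hgrad, hfin⟩ := exists_perturbation hu hr hδ
    (ENNReal.toReal_pos (ENNReal.div_ne_zero.2 ⟨hD, hW⟩) hDW)
  have hgradint : ∫⁻ x in Metric.ball x₀ (2 * r), ‖fderiv ℝ v x‖ₑ ≤ D + D :=
    calc ∫⁻ x in Metric.ball x₀ (2 * r), ‖fderiv ℝ v x‖ₑ
        ≤ ∫⁻ x in Metric.ball x₀ (2 * r), (‖fderiv ℝ u x‖ₑ + D / W) :=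
          lintegral_mono fun x => by simpa only [ENNReal.ofReal_toReal hDW] using hgrad x
      _ = (∫⁻ x in Metric.ball x₀ (2 * r), ‖fderiv ℝ u x‖ₑ) + D / W * W := by
          rw [lintegral_add_right _ measurable_const, setLIntegral_const]
      _ ≤ D + D := by
          rw [ENNReal.div_mul_cancel hW0 hW]
          gcongr
          exact setLIntegral_le_lintegral _ _
  calc cheegerConstant {x | 0 < u x} * ∫⁻ x, ENNReal.ofReal (u x - 2 * δ)
      ≤ _ := cheegerConstant_mul_lintegral_sub_le hu hv hδ.le huv hfin
    _ ≤ K * ∫⁻ x in Metric.ball x₀ (2 * r), ‖fderiv ℝ v x‖ₑ :=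
        hcoarea v x₀ hr (hv.differentiable (by simp)) huc
    _ ≤ K * (D + D) := by gcongr
    _ = 2 * K * D := by ring

theorem lintegral_ofReal_eq_iSup_sub {α : Type*} [MeasurableSpace α] (μ : Measure α)
    {u : α → ℝ} (hu : Measurable u) :
    ∫⁻ x, ENNReal.ofReal (u x) ∂μ =
      ⨆ n : ℕ, ∫⁻ x, ENNReal.ofReal (u x - 2 * (1 / ((n : ℝ) + 1))) ∂μ := by
  have hanti : Antitone fun n : ℕ => 2 * (1 / ((n : ℝ) + 1)) := fun m n hmn => by
    dsimp only
    gcongr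
  rw [← lintegral_iSup (fun n => (hu.sub_const _).ennreal_ofReal) fun m n hmn x =>
    ENNReal.ofReal_le_ofReal (sub_le_sub_left (hanti hmn) _)]
  refine lintegral_congr fun x => (iSup_eq_of_tendsto (fun m n hmn =>
    ENNReal.ofReal_le_ofReal (sub_le_sub_left (hanti hmn) _)) ?_).symm
  simpa using ENNReal.tendsto_ofReal
    (((tendsto_one_div_add_atTop_nhds_zero_nat (𝕜 := ℝ)).const_mul 2).const_sub (u x))

theorem exists_cheegerConstant_mul_lintegral_le (hd : d ≠ 0) : ∃ K : ℝ≥0∞, K ≠ ⊤ ∧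
    ∀ {x₀ : EuclideanSpace ℝ (Fin (d + 1))} {r : ℝ} {u}, u ∈ testFunctions (Metric.ball x₀ r) →
      0 < r → cheegerConstant {x | 0 < u x} * ∫⁻ x, ENNReal.ofReal (u x) ≤
        K * ∫⁻ x, ‖fderiv ℝ u x‖ₑ := by
  obtain ⟨K, hK, h⟩ := exists_cheegerConstant_mul_lintegral_sub_le hd
  refine ⟨K, hK, fun {x₀ r u} hu hr => ?_⟩
  rw [lintegral_ofReal_eq_iSup_sub volume hu.1.continuous.measurable, ENNReal.mul_iSup]
  exact iSup_le fun n => h hu hr Nat.one_div_pos_of_nat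

theorem lintegral_enorm_fderiv_mul_one_sub_le {E : Type*} [NormedAddCommGroup E]
    [NormedSpace ℝ E] [MeasurableSpace E] [BorelSpace E] (μ : Measure E)
    {η φ : E → ℝ} (hη : Differentiable ℝ η) (hφ : ContDiff ℝ 1 φ) {U : Set E}
    (hηU : tsupport η ⊆ U) (h01 : ∀ x, η x ∈ Icc (0 : ℝ) 1) {l : ℝ}
    (hl : ∀ x, ‖fderiv ℝ η x‖ ≤ l) :
    ∫⁻ x, ‖fderiv ℝ (fun x => η x * (1 - φ x)) x‖ₑ ∂μ ≤
      ENNReal.ofReal l * (μ U + ∫⁻ x, ‖φ x‖ₑ ∂μ) + ∫⁻ x, ‖fderiv ℝ φ x‖ₑ ∂μ := by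
  have hpt (x : E) : ‖fderiv ℝ (fun x => η x * (1 - φ x)) x‖ₑ ≤
      ENNReal.ofReal l * (1 + ‖φ x‖ₑ) + ‖fderiv ℝ φ x‖ₑ := by
    refine (enorm_fderiv_mul_const_sub_le (hη x) (hφ.differentiable one_ne_zero x) (h01 x) (hl x)
      1).trans ?_
    gcongr
    exact enorm_sub_le.trans_eq (by rw [enorm_one])
  rw [← setLIntegral_enorm_fderiv μ (tsupport_mul_subset_left.trans hηU)]
  calc ∫⁻ x in U, ‖fderiv ℝ (fun x => η x * (1 - φ x)) x‖ₑ ∂μ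
      ≤ ∫⁻ x in U, (ENNReal.ofReal l * (1 + ‖φ x‖ₑ) + ‖fderiv ℝ φ x‖ₑ) ∂μ := lintegral_mono hpt
    _ = ENNReal.ofReal l * (μ U + ∫⁻ x in U, ‖φ x‖ₑ ∂μ) + ∫⁻ x in U, ‖fderiv ℝ φ x‖ₑ ∂μ := by
      rw [lintegral_add_right _ (hφ.continuous_fderiv one_ne_zero).enorm.measurable,
        lintegral_const_mul' _ _ ENNReal.ofReal_ne_top, lintegral_add_left measurable_const,
        setLIntegral_one]
    _ ≤ _ := by gcongr <;> exact Measure.restrict_le_self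

theorem exists_testFunction_lintegral_fderiv_le {N : ℕ} {S U : Set (EuclideanSpace ℝ (Fin N))}
    {γ γ' : ℝ} {c : ℝ≥0∞} (hγ' : 0 < γ') (hγγ' : γ < γ') (hc0 : c ≠ 0) (hc : c ≠ ⊤)
    (h : relCap 1 S U ≤ ENNReal.ofReal γ * c) :
    ∃ φ ∈ testFunctions U, (∀ x ∈ S, 1 ≤ φ x) ∧ ∫⁻ x, ‖fderiv ℝ φ x‖ₑ ≤ ENNReal.ofReal γ' * c := by
  have hlt : relCap 1 S U < ENNReal.ofReal γ' * c :=
    h.trans_lt (ENNReal.mul_lt_mul_left hc0 hc ((ENNReal.ofReal_lt_ofReal_iff hγ').2 hγγ'))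
  simp only [relCap_one, iInf_lt_iff] at hlt
  obtain ⟨φ, ⟨hφ, hφS⟩, hφc⟩ := hlt
  exact ⟨φ, hφ, hφS, hφc.le⟩

theorem lintegral_enorm_fderiv_cutoff_mul_one_sub_le {N : ℕ} [NeZero N]
    {x₀ : EuclideanSpace ℝ (Fin N)} {r L γ : ℝ} (hr : 0 < r) (hL : 0 ≤ L) (hγ : 0 ≤ γ)
    {η φ : EuclideanSpace ℝ (Fin N) → ℝ} (hη : Differentiable ℝ η)
    (hηs : tsupport η ⊆ Metric.ball x₀ r) (h01 : ∀ x, η x ∈ Icc (0 : ℝ) 1)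
    (hηL : ∀ x, ‖fderiv ℝ η x‖ ≤ L / r) (hφ : φ ∈ testFunctions (Metric.ball x₀ (2 * r)))
    (hφcap : ∫⁻ x, ‖fderiv ℝ φ x‖ₑ ≤
      ENNReal.ofReal γ * relCap 1 (Metric.closedBall x₀ r) (Metric.ball x₀ (2 * r))) :
    ∫⁻ x, ‖fderiv ℝ (fun x => η x * (1 - φ x)) x‖ₑ ≤ ENNReal.ofReal (4 * L * (1 + γ) + γ) *
      relCap 1 (Metric.closedBall x₀ r) (Metric.ball x₀ (2 * r)) := by
  set c := relCap 1 (Metric.closedBall x₀ r) (Metric.ball x₀ (2 * r))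
  have hφ1 := contDiff_one_of_mem_testFunctions hφ
  have hvol : volume (Metric.ball x₀ r) ≤ ENNReal.ofReal (2 * (2 * r)) * c :=
    (measure_mono Metric.ball_subset_closedBall).trans
      (volume_le_mul_relCap_one _ x₀ (by positivity))
  calc ∫⁻ x, ‖fderiv ℝ (fun x => η x * (1 - φ x)) x‖ₑ
      ≤ ENNReal.ofReal (L / r) * (volume (Metric.ball x₀ r) + ∫⁻ x, ‖φ x‖ₑ) +
        ∫⁻ x, ‖fderiv ℝ φ x‖ₑ :=
        lintegral_enorm_fderiv_mul_one_sub_le volume hη hφ1 hηs h01 hηL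
    _ ≤ ENNReal.ofReal (L / r) * (ENNReal.ofReal (2 * (2 * r)) * c +
          ENNReal.ofReal (2 * (2 * r)) * (ENNReal.ofReal γ * c)) + ENNReal.ofReal γ * c := by
        gcongr
        exact (lintegral_enorm_le_of_tsupport_subset_ball volume hφ1 (by positivity)
          hφ.2.2).trans (by gcongr)
    _ = (ENNReal.ofReal (L / r) * ENNReal.ofReal (2 * (2 * r)) * (1 + ENNReal.ofReal γ) +
          ENNReal.ofReal γ) * c := by ring
    _ = ENNReal.ofReal (4 * L * (1 + γ) + γ) * c := by
        rw [← ENNReal.ofReal_one, ← ENNReal.ofReal_add zero_le_one hγ,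
          ← ENNReal.ofReal_mul (by positivity), ← ENNReal.ofReal_mul (by positivity),
          ← ENNReal.ofReal_add (by positivity) hγ]
        congr 3
        field_simp
        ring

theorem exists_testFunction_of_isNegligible (N : ℕ) [NeZero N] {γ : ℝ} (hγ : γ ∈ Ioo (0 : ℝ) 1) :
    ∃ m M : ℝ, 0 < m ∧ ∀ {Ω : Set (EuclideanSpace ℝ (Fin N))} {x₀ r}, 0 < r →
      IsNegligible 1 γ x₀ r (Metric.closedBall x₀ r \ Ω) →
      ∃ u ∈ testFunctions (Metric.ball x₀ r), {x | 0 < u x} ⊆ Ω ∧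
        ENNReal.ofReal (m * r) * relCap 1 (Metric.closedBall x₀ r) (Metric.ball x₀ (2 * r)) ≤
          ∫⁻ x, ENNReal.ofReal (u x) ∧
        ∫⁻ x, ‖fderiv ℝ u x‖ₑ ≤
          ENNReal.ofReal M * relCap 1 (Metric.closedBall x₀ r) (Metric.ball x₀ (2 * r)) := by
  obtain ⟨γ', hγγ', hγ'1⟩ := exists_between hγ.2
  have hγ' : 0 < γ' := hγ.1.trans hγγ'
  obtain ⟨κ, hκ, m, hm, hmass⟩ := exists_mul_relCap_one_le_setLIntegral_one_sub N ⟨hγ', hγ'1⟩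
  obtain ⟨L, hL, hcut⟩ := exists_cutoff (EuclideanSpace ℝ (Fin N)) hκ.1 hκ.2
  refine ⟨m, 4 * L * (1 + γ') + γ', hm, fun {Ω x₀ r} hr hneg => ?_⟩
  obtain ⟨φ, hφ, hφΩ, hφc⟩ := exists_testFunction_lintegral_fderiv_le hγ' hγγ'
    (relCap_one_closedBall_ne_zero x₀ hr (by positivity))
    (relCap_one_closedBall_ne_top x₀ hr (by linarith)) hneg.2.2
  obtain ⟨η, hη, h01, hη1, hηs, hηL⟩ := hcut x₀ r hr
  rw [one_mul] at hηs
  have hu : (fun x => η x * (1 - φ x)) ∈ testFunctions (Metric.ball x₀ r) :=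
    mem_testFunctions_of_tsupport_subset_ball (hη.mul (contDiff_const.sub hφ.1))
      (tsupport_mul_subset_left.trans hηs)
  refine ⟨_, hu, fun x (hx : 0 < η x * (1 - φ x)) => ?_,
    (hmass x₀ r hr φ hφ hφc).trans ?_,
    lintegral_enorm_fderiv_cutoff_mul_one_sub_le hr hL.le hγ'.le (hη.differentiable (by simp))
      hηs h01 hηL hφ hφc⟩
  · by_contra hxΩ
    have hxr : x ∈ Metric.closedBall x₀ r :=
      Metric.ball_subset_closedBall (hu.2.2 (subset_tsupport _ hx.ne'))
    exact hx.not_ge (mul_nonpos_of_nonneg_of_nonpos (h01 x).1 (sub_nonpos.2 (hφΩ x ⟨hxr, hxΩ⟩)))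
  · refine (setLIntegral_congr_fun measurableSet_ball fun x hx => ?_).trans_le
      (setLIntegral_le_lintegral (Metric.ball x₀ (κ * r)) _)
    simp only [hη1 x (Metric.ball_subset_closedBall hx), one_mul]

theorem exists_cheegerConstant_mul_le_of_isNegligible (hd : d ≠ 0) {γ : ℝ}
    (hγ : γ ∈ Ioo (0 : ℝ) 1) : ∃ C : ℝ≥0∞, C ≠ ⊤ ∧
      ∀ {Ω : Set (EuclideanSpace ℝ (Fin (d + 1)))} {x₀ r}, 0 < r →
        IsNegligible 1 γ x₀ r (Metric.closedBall x₀ r \ Ω) →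
        cheegerConstant Ω * ENNReal.ofReal r ≤ C := by
  obtain ⟨m, M, hm, htest⟩ := exists_testFunction_of_isNegligible (d + 1) hγ
  obtain ⟨K, hK, hcheeger⟩ := exists_cheegerConstant_mul_lintegral_le hd
  have hm0 : ENNReal.ofReal m ≠ 0 := (ENNReal.ofReal_pos.2 hm).ne'
  refine ⟨K * ENNReal.ofReal M / ENNReal.ofReal m, by finiteness, fun {Ω x₀ r} hr hneg => ?_⟩
  obtain ⟨u, hu, huΩ, hmass, hgrad⟩ := htest hr hneg
  set c := relCap 1 (Metric.closedBall x₀ r) (Metric.ball x₀ (2 * r))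
  have hc0 : c ≠ 0 := relCap_one_closedBall_ne_zero x₀ hr (by positivity)
  have hc : c ≠ ⊤ := relCap_one_closedBall_ne_top x₀ hr (by linarith)
  rw [ENNReal.le_div_iff_mul_le (Or.inl hm0) (Or.inl ENNReal.ofReal_ne_top),
    ← ENNReal.mul_le_mul_iff_left hc0 hc]
  calc cheegerConstant Ω * ENNReal.ofReal r * ENNReal.ofReal m * c
      = cheegerConstant Ω * (ENNReal.ofReal (m * r) * c) := by
        rw [ENNReal.ofReal_mul hm.le]
        ring
    _ ≤ cheegerConstant {x | 0 < u x} * ∫⁻ x, ENNReal.ofReal (u x) :=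
        mul_le_mul' (cheegerConstant_anti huΩ) hmass
    _ ≤ K * ∫⁻ x, ‖fderiv ℝ u x‖ₑ := hcheeger hu hr
    _ ≤ K * (ENNReal.ofReal M * c) := by gcongr
    _ = K * ENNReal.ofReal M * c := by ring

theorem exists_cheegerConstant_le_div_capInradius {N : ℕ} (hN : 2 ≤ N) {γ : ℝ}
    (hγ : γ ∈ Ioo (0 : ℝ) 1) : ∃ C : ℝ, 0 < C ∧ ∀ Ω : Set (EuclideanSpace ℝ (Fin N)),
      cheegerConstant Ω ≤ ENNReal.ofReal C / capInradius 1 γ Ω := by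
  obtain ⟨d, rfl⟩ : ∃ d, N = d + 1 := ⟨N - 1, by omega⟩
  obtain ⟨C, hC, h⟩ := exists_cheegerConstant_mul_le_of_isNegligible (d := d) (by omega) hγ
  refine ⟨C.toReal + 1, by positivity, fun Ω => ?_⟩
  have hC1 : C ≤ ENNReal.ofReal (C.toReal + 1) :=
    (ENNReal.le_ofReal_iff_toReal_le hC (by positivity)).2 (by linarith)
  rw [ENNReal.le_div_iff_mul_le (Or.inr (ENNReal.ofReal_pos.2 (by positivity)).ne')
    (Or.inr ENNReal.ofReal_ne_top), capInradius]
  simp_rw [ENNReal.mul_iSup]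
  exact iSup₂_le fun r ⟨hr, x₀, hx₀⟩ => (h hr hx₀).trans hC1

end UpperBound

section Shell

variable {N : ℕ}

theorem one_le_capInradius_shell (hN : 2 ≤ N) {γ : ℝ} (hγ : γ ∈ Ioo (0 : ℝ) 1) :
    1 ≤ capInradius 1 γ
      (Metric.ball (0 : EuclideanSpace ℝ (Fin N)) (2 - γ) \ Metric.closedBall 0 γ) := by
  obtain ⟨hγ0, hγ1⟩ := hγ
  set Ω := Metric.ball (0 : EuclideanSpace ℝ (Fin N)) (2 - γ) \ Metric.closedBall 0 γ
  have hsub : Metric.closedBall 0 1 \ Ω ⊆ Metric.closedBall 0 γ := fun x hx => by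
    by_contra hxγ
    exact hx.2 ⟨Metric.closedBall_subset_ball (by linarith) hx.1, hxγ⟩
  rw [← ENNReal.ofReal_one]
  refine le_iSup₂_of_le (f := fun (r : ℝ) _ => ENNReal.ofReal r) 1 ⟨one_pos, 0,
    (isCompact_closedBall _ _).diff (Metric.isOpen_ball.sdiff Metric.isClosed_closedBall),
    sdiff_subset, ?_⟩ le_rfl
  calc relCap 1 (Metric.closedBall 0 1 \ Ω) (Metric.ball 0 (2 * 1))
      ≤ relCap 1 (Metric.closedBall (0 : EuclideanSpace ℝ (Fin N)) (γ * 1))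
          (Metric.ball 0 (γ * (2 * 1))) :=
        relCap_one_mono (by rwa [mul_one]) (Metric.ball_subset_ball (by linarith))
    _ = ENNReal.ofReal (γ ^ N / γ) *
          relCap 1 (Metric.closedBall (0 : EuclideanSpace ℝ (Fin N)) 1) (Metric.ball 0 (2 * 1)) :=
        relCap_one_closedBall_mul 0 0 1 (2 * 1) hγ0
    _ ≤ _ := by
        gcongr
        rw [div_le_iff₀ hγ0, ← sq]
        exact pow_le_pow_of_le_one hγ0.le hγ1.le hN

theorem exists_tendsto_cheegerConstant_shell (hN : 2 ≤ N) :
    ∃ c : ℝ → ℝ, Tendsto c (𝓝[<] 1) atTop ∧ ∀ γ ∈ Ioo (0 : ℝ) 1, 0 < c γ ∧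
      ENNReal.ofReal (c γ) ≤ cheegerConstant
        (Metric.ball (0 : EuclideanSpace ℝ (Fin N)) (2 - γ) \ Metric.closedBall 0 γ) := by
  obtain ⟨K, hK, hcheeger⟩ := exists_div_le_cheegerConstant_of_poincare hN
  let A (γ : ℝ) : ℝ :=
    (1 - γ / (2 - γ)) * ((2 - γ) / (γ / (2 - γ))) * ((γ / (2 - γ)) ^ N)⁻¹
  have hA0 (γ) (hγ : γ ∈ Ioo (0 : ℝ) 1) : 0 < A γ := by
    obtain ⟨hγ0, hγ1⟩ := hγ
    have hpos : 0 < 2 - γ := by linarith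
    have hlt : 0 < 1 - γ / (2 - γ) := sub_pos.2 ((div_lt_one hpos).2 (by linarith))
    positivity
  have hA : Tendsto A (𝓝[<] 1) (𝓝[>] 0) := by
    refine tendsto_nhdsWithin_iff.2 ⟨?_, mem_of_superset (Ioo_mem_nhdsLT zero_lt_one) hA0⟩
    have hcont : ContinuousAt A 1 := by fun_prop (disch := norm_num)
    rw [show 0 = A 1 by norm_num [A]]
    exact hcont.tendsto.mono_left nhdsWithin_le_nhds
  refine ⟨fun γ => K / A γ, hA.inv_tendsto_nhdsGT_zero.const_mul_atTop hK, fun γ hγ =>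
    ⟨div_pos hK (hA0 γ hγ), hcheeger (hA0 γ hγ) fun u hu => ?_⟩⟩
  simpa only [finrank_euclideanSpace_fin] using lintegral_enorm_le_of_tsupport_subset_shell volume
    (contDiff_one_of_mem_testFunctions hu) hγ.1 (by linarith [hγ.2]) hu.2.2

theorem tendsto_atTop_of_cheegerConstant_le (hN : 2 ≤ N) {C : ℝ → ℝ}
    (hC : ∀ γ ∈ Ioo (0 : ℝ) 1, ∀ Ω : Set (EuclideanSpace ℝ (Fin N)), IsOpen Ω →
      cheegerConstant Ω ≤ ENNReal.ofReal (C γ) / capInradius 1 γ Ω) :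
    Tendsto C (𝓝[<] 1) atTop := by
  obtain ⟨c, hc, hshell⟩ := exists_tendsto_cheegerConstant_shell hN
  refine tendsto_atTop_mono' _ (mem_of_superset (Ioo_mem_nhdsLT zero_lt_one) fun γ hγ => ?_) hc
  obtain ⟨hcpos, hcle⟩ := hshell γ hγ
  have hle : ENNReal.ofReal (c γ) ≤ ENNReal.ofReal (C γ) :=
    calc ENNReal.ofReal (c γ)
        ≤ cheegerConstant
            (Metric.ball (0 : EuclideanSpace ℝ (Fin N)) (2 - γ) \ Metric.closedBall 0 γ) := hcle
      _ ≤ ENNReal.ofReal (C γ) / capInradius 1 γ _ :=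
        hC γ hγ _ (Metric.isOpen_ball.sdiff Metric.isClosed_closedBall)
      _ ≤ ENNReal.ofReal (C γ) / 1 :=
        ENNReal.div_le_div_left (one_le_capInradius_shell hN hγ) _
      _ = ENNReal.ofReal (C γ) := div_one _
  exact (ENNReal.ofReal_le_ofReal_iff'.1 hle).resolve_right hcpos.not_ge

theorem cheegerConstant_pos_iff (hN : 2 ≤ N) {γ : ℝ} (hγ : γ ∈ Ioo (0 : ℝ) 1)
    {Ω : Set (EuclideanSpace ℝ (Fin N))} (hΩ : IsOpen Ω) :
    0 < cheegerConstant Ω ↔ capInradius 1 γ Ω < ⊤ := by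
  obtain ⟨σ, hσ, hlower⟩ := exists_div_capInradius_le_cheegerConstant hN
  obtain ⟨C, -, hupper⟩ := exists_cheegerConstant_le_div_capInradius hN hγ
  refine ⟨fun h => lt_top_iff_ne_top.2 fun htop => h.not_ge ?_, fun h => ?_⟩
  · simpa only [htop, ENNReal.div_top] using hupper Ω
  · exact (ENNReal.div_pos (ENNReal.ofReal_pos.2 (mul_pos hσ hγ.1)).ne' h.ne).trans_le
      (hlower γ hγ Ω hΩ)

end Shell

end CapacitaryInradius

theorem corollary1 (N : ℕ) (hN : 2 ≤ N) :
    ∃ σ : ℝ, 0 < σ ∧ ∃ C : ℝ → ℝ, (∀ γ ∈ Ioo (0 : ℝ) 1, 0 < C γ) ∧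
      -- the two-sided estimate
      (∀ γ ∈ Ioo (0 : ℝ) 1, ∀ Ω : Set (EuclideanSpace ℝ (Fin N)), IsOpen Ω →
        ENNReal.ofReal (σ * γ) / CapacitaryInradius.capInradius 1 γ Ω
            ≤ CapacitaryInradius.cheegerConstant Ω ∧
        CapacitaryInradius.cheegerConstant Ω
            ≤ ENNReal.ofReal (C γ) / CapacitaryInradius.capInradius 1 γ Ω) ∧
      -- the constant of the upper bound diverges as `γ` goes to `1` ...
      Tendsto C (𝓝[<] 1) atTop ∧
      -- ... and so does every constant for which the upper bound holds
      (∀ C' : ℝ → ℝ,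
        (∀ γ ∈ Ioo (0 : ℝ) 1, ∀ Ω : Set (EuclideanSpace ℝ (Fin N)), IsOpen Ω →
          CapacitaryInradius.cheegerConstant Ω
            ≤ ENNReal.ofReal (C' γ) / CapacitaryInradius.capInradius 1 γ Ω) →
        Tendsto C' (𝓝[<] 1) atTop) ∧
      -- positivity of the Cheeger constant
      (∀ γ ∈ Ioo (0 : ℝ) 1, ∀ Ω : Set (EuclideanSpace ℝ (Fin N)), IsOpen Ω →
        (0 < CapacitaryInradius.cheegerConstant Ω ↔
          CapacitaryInradius.capInradius 1 γ Ω < ⊤)) ∧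
      -- finiteness of the capacitary inradius does not depend on `γ`
      (∀ γ ∈ Ioo (0 : ℝ) 1, ∀ γ' ∈ Ioo (0 : ℝ) 1,
        ∀ Ω : Set (EuclideanSpace ℝ (Fin N)), IsOpen Ω →
          (CapacitaryInradius.capInradius 1 γ Ω < ⊤ ↔
            CapacitaryInradius.capInradius 1 γ' Ω < ⊤)) := by
  obtain ⟨σ, hσ, hlower⟩ := CapacitaryInradius.exists_div_capInradius_le_cheegerConstant hN
  choose! C hCpos hupper using fun (γ : ℝ) (hγ : γ ∈ Ioo (0 : ℝ) 1) =>
    CapacitaryInradius.exists_cheegerConstant_le_div_capInradius hN hγ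
  exact ⟨σ, hσ, C, hCpos, fun γ hγ Ω hΩ => ⟨hlower γ hγ Ω hΩ, hupper γ hγ Ω⟩,
    CapacitaryInradius.tendsto_atTop_of_cheegerConstant_le hN fun γ hγ Ω _ => hupper γ hγ Ω,
    fun C' hC' => CapacitaryInradius.tendsto_atTop_of_cheegerConstant_le hN hC',
    fun γ hγ Ω hΩ => CapacitaryInradius.cheegerConstant_pos_iff hN hγ hΩ,
    fun γ hγ γ' hγ' Ω hΩ => (CapacitaryInradius.cheegerConstant_pos_iff hN hγ hΩ).symm.trans
      (CapacitaryInradius.cheegerConstant_pos_iff hN hγ' hΩ)⟩
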